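/- Let $N\ge 1$ and let $\Omega\subset\mathbb{R}^N$ be open, bounded, and with the uniform interior cone condition (there are an opening and a radius such that each $x\in\Omega$ is the vertex of a right circular cone with that opening and radius contained in $\Omega$). Let $p\in(1,+\infty)$, $m\in(1,+\infty]$, let $a_1,a_2\in L^m(\Omega)$, and for some $\beta\in(0,1]$ let $u_1,u_2\in C^{0,\beta}(\overline\Omega)$ be weak solutions, positive in $\Omega$, of $$-\Delta_p u_i=a_i \ \text{ in }\Omega,\qquad u_i=0\ \text{ on }\partial\Omega ,$$ that is, $u_i\in W^{1,p}_0(\Omega)$ and $\int_\Omega|\nabla u_i|^{p-2}\nabla u_i\cdot\nabla\varphi=\int_\Omega a_i\varphi$ for all $\varphi\in C_c^\infty(\Omega)$. Write $\|u\|_{C^{0,\beta}}=\|u\|_\infty+\sup_{x\neq y\in\Omega}\frac{|u(x)-u(y)|}{|x-y|^\beta}$ and, for $q\in[1,+\infty)$, $\kappa_q=\dfrac{\beta}{\beta+N/q}\in(0,1)$. (i) Assume $p\ge 2$ and $m\ge\frac{p}{p-2}$ (that is, $m=+\infty$ if $p=2$). Let $q=\frac{Np}{N-p}$ if $p<N$,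 and let $q\in[1,+\infty)$ be arbitrary if $p\ge N$. Then $$\|u_1-u_2\|_\infty\le C\,\|a_1-a_2\|_{m}^{\frac{\kappa_q}{p-1}},$$ where $C>0$ depends only on $p,m,\Omega,q,\|u_1\|_{C^{0,\beta}},\|u_2\|_{C^{0,\beta}}$. (ii) Assume $p\le 2$, $m\ge 2$ and $u_1,u_2\in W^{1,\infty}(\Omega)$. Let $q=\frac{2N}{N-2}$ if $N\ge 3$, and let $q\in[1,+\infty)$ be arbitrary if $N\le 2$. Then $$\|u_1-u_2\|_\infty\le C\,\|a_1-a_2\|_{m}^{\kappa_q},$$ where $C>0$ depends only on $p,m,\Omega,q,\|u_1\|_{C^{0,\beta}},\|u_2\|_{C^{0,\beta}},\|\nabla u_1\|_\infty,\|\nabla u_2\|_\infty$. -/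

import Mathlib

open MeasureTheory Set Filter Topology
open scoped ENNReal NNReal ContDiff

noncomputable section

/-- The Euclidean space `ℝ^N`. -/
abbrev Eucl (N : ℕ) : Type := EuclideanSpace ℝ (Fin N)

/-- The open finite right circular cone with vertex `x`, axis direction `ξ` (a unit vector),
half-opening `θ` and radius `r`. -/
def finiteCone {N : ℕ} (x ξ : Eucl N) (θ r : ℝ) : Set (Eucl N) :=
  {y | ‖y - x‖ < r ∧ ‖y - x‖ * Real.cos θ < inner ℝ (y - x) ξ}

/-- Uniform interior cone condition: there are a half-opening `θ ∈ (0, π/2)` and a radius `r > 0`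
such that every point of `Ω` is the vertex of a cone with these parameters contained in `Ω`. -/
def UniformInteriorCone {N : ℕ} (Ω : Set (Eucl N)) : Prop :=
  ∃ θ r : ℝ, 0 < θ ∧ θ < Real.pi / 2 ∧ 0 < r ∧
    ∀ x ∈ Ω, ∃ ξ : Eucl N, ‖ξ‖ = 1 ∧ finiteCone x ξ θ r ⊆ Ω

/-- `φ ∈ C_c^∞(Ω)`. -/
def IsTestFunction {N : ℕ} (Ω : Set (Eucl N)) (φ : Eucl N → ℝ) : Prop :=
  ContDiff ℝ ∞ φ ∧ HasCompactSupport φ ∧ tsupport φ ⊆ Ω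

/-- `G` is the weak (distributional) gradient of `u` on `Ω`. -/
def HasWeakGradient {N : ℕ} (Ω : Set (Eucl N)) (u : Eucl N → ℝ) (G : Eucl N → Eucl N) : Prop :=
  LocallyIntegrableOn u Ω ∧ LocallyIntegrableOn G Ω ∧
    ∀ φ : Eucl N → ℝ, IsTestFunction Ω φ →
      ∫ x in Ω, u x • gradient φ x = - ∫ x in Ω, φ x • G x

/-- `u ∈ W_0^{1,p}(Ω)` with weak gradient `G`: the pair `(u, G)` is the limit in `L^p(Ω)` of pairs
`(φ n, ∇ (φ n))` with `φ n ∈ C_c^∞(Ω)`. -/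
def MemSobolevZero {N : ℕ} (Ω : Set (Eucl N)) (p : ℝ) (u : Eucl N → ℝ) (G : Eucl N → Eucl N) :
    Prop :=
  MemLp u (ENNReal.ofReal p) (volume.restrict Ω) ∧
  MemLp G (ENNReal.ofReal p) (volume.restrict Ω) ∧
  HasWeakGradient Ω u G ∧
  ∃ φ : ℕ → Eucl N → ℝ, (∀ n, IsTestFunction Ω (φ n)) ∧
    Tendsto (fun n => eLpNorm (φ n - u) (ENNReal.ofReal p) (volume.restrict Ω)) atTop (𝓝 0) ∧
    Tendsto (fun n => eLpNorm (gradient (φ n) - G) (ENNReal.ofReal p) (volume.restrict Ω))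
      atTop (𝓝 0)

/-- `u` is a weak solution of `-Δ_p u = a` in `Ω`, `u = 0` on `∂Ω`: `u ∈ W_0^{1,p}(Ω)` and
`∫_Ω |∇u|^{p-2} ∇u · ∇φ = ∫_Ω a φ` for every test function `φ`. -/
def IsWeakSolution {N : ℕ} (Ω : Set (Eucl N)) (p : ℝ) (a u : Eucl N → ℝ) : Prop :=
  ∃ G : Eucl N → Eucl N, MemSobolevZero Ω p u G ∧
    ∀ φ : Eucl N → ℝ, IsTestFunction Ω φ →
      ∫ x in Ω, ‖G x‖ ^ (p - 2) * inner ℝ (G x) (gradient φ x) = ∫ x in Ω, a x * φ x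

/-- `u` is a weak solution of the Dirichlet problem for `-Δ_p u = a` that is positive in `Ω`
and belongs to `C^{0,β}(closure Ω)`. -/
def IsPositiveHolderSolution {N : ℕ} (Ω : Set (Eucl N)) (p : ℝ) (β : ℝ≥0) (a u : Eucl N → ℝ) :
    Prop :=
  IsWeakSolution Ω p a u ∧ (∀ x ∈ Ω, 0 < u x) ∧ MemHolder β ((closure Ω).domRestrict u)

/-- The norm `‖u‖_{C^{0,β}(Ω)} = ‖u‖_∞ + [u]_{C^{0,β}}`. -/
def holderNorm {N : ℕ} (Ω : Set (Eucl N)) (β : ℝ≥0) (u : Eucl N → ℝ) : ℝ :=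
  (eLpNorm u ∞ (volume.restrict Ω)).toReal + nnHolderNorm β (Ω.domRestrict u)

/-- The essential supremum `‖G‖_{L^∞(Ω)}` of a (bounded) vector field. -/
def supNorm {N : ℕ} (Ω : Set (Eucl N)) (G : Eucl N → Eucl N) : ℝ :=
  (eLpNorm G ∞ (volume.restrict Ω)).toReal

/-- The choice of `q`: the critical exponent `q = s^* = N s / (N - s)` if `s < N`, and an
arbitrary finite `q ≥ 1` if `s ≥ N`. -/
def AdmissibleExponent (N : ℕ) (s q : ℝ) : Prop :=
  (s < N ∧ q = N * s / (N - s)) ∨ ((N : ℝ) ≤ s ∧ 1 ≤ q)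

/-- The interpolation exponent `κ_q = β / (β + N / q)`. -/
def kappa (N : ℕ) (β : ℝ≥0) (q : ℝ) : ℝ := β / (β + N / q)

end

/-! Write `w = u₁ - u₂` and let `r = p` in case (i), `r = 2` in case (ii). Testing the difference of
the equations with `w` gives `∫ ⟨|∇u₁|^(p-2)∇u₁ - |∇u₂|^(p-2)∇u₂, ∇w⟩ = ∫ (a₁ - a₂) w`. Strong
monotonicity bounds the left side below by `c ∫ |∇w|^r`, with `c = 2^(1-p)` for `p ≥ 2`
(`le_inner_rpow_smul_sub_of_two_le`) and `c = (p-1) L^(p-2)` for `p ≤ 2` when both gradients are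
bounded by `L` (`le_inner_rpow_smul_sub_of_le_two`). Hölder and Poincaré bound the right side by a
multiple of `‖a₁ - a₂‖_m ‖∇w‖_r`. Dividing (`eLpNorm_le_of_coercive`) and applying Sobolev gives
`‖w‖_q ≤ R ‖a₁ - a₂‖_m^(1/(r-1))`.

The sup norm is recovered by interpolation (`exists_eLpNorm_top_le_of_holder`). If `|w x| = M` and
`w` has Hölder constant `H`, then `|w| ≥ M/2` on the part of the cone at `x` within distance of
order `(M/H)^(1/β)`. This part contains a ball of comparable radius, so `M (M/H)^(N/(βq))` is at
most a multiple of `‖w‖_q`; solving for `M` produces the exponent `κ_q`. All constants are kept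
independent of `β`.

In case (ii) the test functions approximating `w` converge only in `W^{1,p}`, while the energy lives
in `L²`. The Sobolev inequality is then obtained by mollifying the extension of `w` by zero
(`exists_eLpNorm_le_of_isTestLimit_of_memLp_top`). -/

/-! ### Strong monotonicity of the vector field `a ↦ |a|^(p-2) a`. -/

section VectorInequalities

variable {E : Type*} [NormedAddCommGroup E] [InnerProductSpace ℝ E]

/-- For `s = ‖a‖^(p-2)` and `t = ‖b‖^(p-2)` the last term is nonnegative when `p ≥ 2`; for `p ≤ 2`
and nonzero vectors it is nonpositive and must be absorbed. -/
theorem inner_smul_sub_smul_eq (s t : ℝ) (a b : E) :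
    inner ℝ (s • a - t • b) (a - b) =
      (s + t) / 2 * ‖a - b‖ ^ 2 + (s - t) / 2 * (‖a‖ ^ 2 - ‖b‖ ^ 2) := by
  have h := norm_sub_sq_real a b
  simp only [inner_sub_left, inner_sub_right, real_inner_smul_left, real_inner_self_eq_norm_sq,
    real_inner_comm a b]
  rw [h]; ring

theorem le_inner_rpow_smul_sub_of_two_le {p : ℝ} (hp : 2 ≤ p) (a b : E) :
    2 ^ (1 - p) * ‖a - b‖ ^ p ≤
      inner ℝ (‖a‖ ^ (p - 2) • a - ‖b‖ ^ (p - 2) • b) (a - b) := by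
  rw [inner_smul_sub_smul_eq]
  have h2 : 0 ≤ (‖a‖ ^ (p - 2) - ‖b‖ ^ (p - 2)) / 2 * (‖a‖ ^ 2 - ‖b‖ ^ 2) := by
    rcases le_total ‖a‖ ‖b‖ with h | h
    · have := Real.rpow_le_rpow (norm_nonneg a) h (by linarith : 0 ≤ p - 2)
      have h' : ‖a‖ ^ 2 ≤ ‖b‖ ^ 2 := by gcongr
      exact mul_nonneg_of_nonpos_of_nonpos (by linarith) (by linarith)
    · have := Real.rpow_le_rpow (norm_nonneg b) h (by linarith : 0 ≤ p - 2)
      have h' : ‖b‖ ^ 2 ≤ ‖a‖ ^ 2 := by gcongr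
      exact mul_nonneg (by linarith) (by linarith)
  have hm : ‖a - b‖ ^ (p - 2) ≤ 2 ^ (p - 2) * (‖a‖ ^ (p - 2) + ‖b‖ ^ (p - 2)) := by
    have h0 : ‖a - b‖ ≤ 2 * max ‖a‖ ‖b‖ := by
      have := norm_sub_le a b
      have := le_max_left ‖a‖ ‖b‖
      have := le_max_right ‖a‖ ‖b‖
      linarith
    calc ‖a - b‖ ^ (p - 2) ≤ (2 * max ‖a‖ ‖b‖) ^ (p - 2) :=
          Real.rpow_le_rpow (norm_nonneg _) h0 (by linarith)
      _ = 2 ^ (p - 2) * (max ‖a‖ ‖b‖) ^ (p - 2) :=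
          Real.mul_rpow (by norm_num) (le_max_of_le_left (norm_nonneg _))
      _ ≤ _ := by
          gcongr
          have ha : 0 ≤ ‖a‖ ^ (p - 2) := by positivity
          have hb : 0 ≤ ‖b‖ ^ (p - 2) := by positivity
          rcases max_choice ‖a‖ ‖b‖ with h | h <;> rw [h] <;> linarith
  have hpow : ‖a - b‖ ^ p = ‖a - b‖ ^ (p - 2) * ‖a - b‖ ^ 2 := by
    rw [← Real.rpow_natCast, ← Real.rpow_add_of_nonneg (norm_nonneg _) (by linarith) (by norm_num)]
    norm_num
  have hc : (2 : ℝ) ^ (1 - p) * 2 ^ (p - 2) = 1 / 2 := by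
    rw [← Real.rpow_add (by norm_num)]; ring_nf
    rw [Real.rpow_neg_one]; norm_num
  rw [hpow]
  calc (2 : ℝ) ^ (1 - p) * (‖a - b‖ ^ (p - 2) * ‖a - b‖ ^ 2)
      ≤ 2 ^ (1 - p) * ((2 ^ (p - 2) * (‖a‖ ^ (p - 2) + ‖b‖ ^ (p - 2))) * ‖a - b‖ ^ 2) := by
        gcongr
    _ = (2 ^ (1 - p) * 2 ^ (p - 2)) * ((‖a‖ ^ (p - 2) + ‖b‖ ^ (p - 2)) * ‖a - b‖ ^ 2) := by ring
    _ ≤ _ := by rw [hc]; linarith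

/-- The concave function `t ↦ t^(p-1)` lies below its tangent at `α` (Bernoulli), and its slope
there is at least `(p-1) L^(p-2)`. -/
theorem rpow_sub_one_sub_mul_sub_ge {p L α β : ℝ} (hp : 1 < p) (hp2 : p ≤ 2) (hβ : 0 < β)
    (hαβ : β ≤ α) (hαL : α ≤ L) :
    (p - 1) * L ^ (p - 2) * (α - β) ^ 2 ≤ (α ^ (p - 1) - β ^ (p - 1)) * (α - β) := by
  have hα : 0 < α := hβ.trans_le hαβ
  have hb := rpow_one_add_le_one_add_mul_self (s := (β - α) / α)
    (by rw [le_div_iff₀ hα]; linarith) (p := p - 1) (by linarith) (by linarith)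
  have h1 : 1 + (β - α) / α = β / α := by field_simp; ring
  rw [h1, Real.div_rpow hβ.le hα.le, div_le_iff₀ (by positivity)] at hb
  have h2 : α ^ (p - 1) = α ^ (p - 2) * α := by
    rw [← Real.rpow_add_one hα.ne']; ring_nf
  have h3 : (p - 1) * α ^ (p - 2) * (α - β) ≤ α ^ (p - 1) - β ^ (p - 1) := by
    have : (1 + (p - 1) * ((β - α) / α)) * α ^ (p - 1) =
        α ^ (p - 1) - (p - 1) * α ^ (p - 2) * (α - β) := by
      rw [h2]; field_simp; ring
    linarith
  have h4 : L ^ (p - 2) ≤ α ^ (p - 2) :=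
    Real.rpow_le_rpow_of_nonpos hα hαL (by linarith)
  calc (p - 1) * L ^ (p - 2) * (α - β) ^ 2 = ((p - 1) * L ^ (p - 2) * (α - β)) * (α - β) := by ring
    _ ≤ ((p - 1) * α ^ (p - 2) * (α - β)) * (α - β) := by
        have : 0 ≤ α - β := by linarith
        have : 0 ≤ p - 1 := by linarith
        gcongr
    _ ≤ _ := by gcongr

theorem le_inner_rpow_smul_sub_of_le_two {p L : ℝ} (hp : 1 < p) (hp2 : p ≤ 2) (a b : E)
    (ha : ‖a‖ ≤ L) (hb : ‖b‖ ≤ L) :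
    (p - 1) * L ^ (p - 2) * ‖a - b‖ ^ 2 ≤
      inner ℝ (‖a‖ ^ (p - 2) • a - ‖b‖ ^ (p - 2) • b) (a - b) := by
  wlog hab : ‖b‖ ≤ ‖a‖ generalizing a b
  · have := this b a hb ha (le_of_not_ge hab)
    rw [norm_sub_rev] at this
    refine this.trans_eq ?_
    rw [← inner_neg_neg]; simp
  -- The zero vector is separate: `0 ^ (p - 2)` is `0` for `p < 2`, so `L^(p-2) ≤ ‖b‖^(p-2)` would
  -- fail.
  rcases (norm_nonneg b).eq_or_lt with hb0 | hb0
  · have hb' : b = 0 := norm_eq_zero.1 hb0.symm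
    subst hb'
    rcases (norm_nonneg a).eq_or_lt with ha0 | ha0
    · have ha' : a = 0 := norm_eq_zero.1 ha0.symm
      simp [ha']
    · have h4 : L ^ (p - 2) ≤ ‖a‖ ^ (p - 2) :=
        Real.rpow_le_rpow_of_nonpos ha0 ha (by linarith)
      have h5 : 0 ≤ L ^ (p - 2) := Real.rpow_nonneg (by linarith) _
      simp only [smul_zero, sub_zero, real_inner_smul_left, real_inner_self_eq_norm_sq]
      gcongr
      nlinarith
  have ha0 : 0 < ‖a‖ := hb0.trans_le hab
  have hL : 0 < L := ha0.trans_le ha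
  rw [inner_smul_sub_smul_eq]
  have key := rpow_sub_one_sub_mul_sub_ge hp hp2 hb0 hab ha
  have e1 : ‖a‖ ^ (p - 1) = ‖a‖ ^ (p - 2) * ‖a‖ := by
    rw [← Real.rpow_add_one ha0.ne']; ring_nf
  have e2 : ‖b‖ ^ (p - 1) = ‖b‖ ^ (p - 2) * ‖b‖ := by
    rw [← Real.rpow_add_one hb0.ne']; ring_nf
  rw [e1, e2] at key
  have h4 : L ^ (p - 2) ≤ ‖a‖ ^ (p - 2) := Real.rpow_le_rpow_of_nonpos ha0 ha (by linarith)
  have h5 : L ^ (p - 2) ≤ ‖b‖ ^ (p - 2) := Real.rpow_le_rpow_of_nonpos hb0 hb (by linarith)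
  have h6 : 0 < L ^ (p - 2) := by positivity
  have hd : (‖a‖ - ‖b‖) ^ 2 ≤ ‖a - b‖ ^ 2 := by
    have := norm_sub_norm_le a b
    have : 0 ≤ ‖a‖ - ‖b‖ := by linarith
    gcongr
  -- Right side minus left side is affine in `‖a - b‖²` with nonnegative slope by `hs`, so the worst
  -- case is `‖a - b‖ = ‖a‖ - ‖b‖`, which is the scalar inequality `key`.
  have hs : (p - 1) * L ^ (p - 2) ≤ (‖a‖ ^ (p - 2) + ‖b‖ ^ (p - 2)) / 2 := by nlinarith
  nlinarith [mul_nonneg (sub_nonneg.2 hs) (sub_nonneg.2 hd)]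

end VectorInequalities

/-! ### Interpolation between Hölder and `L^q` bounds on cone domains. -/

section Interpolation

/-- Solving for `M` puts exponents in `[0, 1]` on `H` and `c⁻¹`. Replacing these powers by `1 + H`
and `max 1 c⁻¹` removes `t`, hence later `β`, from the constant. -/
theorem le_rpow_of_mul_rpow_le {M H c t X : ℝ} (hM : 0 < M) (hH : 0 < H) (hc : 0 < c)
    (ht : 0 ≤ t) (h : M / 2 * (c * (M / (2 * H)) ^ t) ≤ X) :
    M ≤ 2 * max 1 c⁻¹ * (1 + H) * X ^ (1 / (1 + t)) := by
  have hX : 0 < X := lt_of_lt_of_le (by positivity) h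
  have h1t : 0 < 1 + t := by linarith
  have hk0 : 0 ≤ 1 / (1 + t) := by positivity
  have hk1 : 1 / (1 + t) ≤ 1 := by rw [div_le_one h1t]; linarith
  have e : M / (2 * H) = M / 2 / H := by field_simp
  have h2 : (M / 2) ^ (1 + t) ≤ X * (H ^ t * c⁻¹) := by
    rw [e, Real.div_rpow (by positivity) hH.le] at h
    rw [Real.rpow_add (by positivity), Real.rpow_one]
    have : M / 2 * (M / 2) ^ t = M / 2 * (c * ((M / 2) ^ t / H ^ t)) * (H ^ t * c⁻¹) := by
      field_simp
    rw [this]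
    gcongr
  have h3 : M / 2 ≤ (X * (H ^ t * c⁻¹)) ^ (1 / (1 + t)) := by
    have := Real.rpow_le_rpow (by positivity) h2 hk0
    rwa [← Real.rpow_mul (by positivity), mul_one_div_cancel h1t.ne', Real.rpow_one] at this
  rw [Real.mul_rpow hX.le (by positivity), Real.mul_rpow (by positivity) (by positivity),
    ← Real.rpow_mul hH.le] at h3
  have h4 : H ^ (t * (1 / (1 + t))) ≤ 1 + H := by
    calc H ^ (t * (1 / (1 + t))) ≤ (1 + H) ^ (t * (1 / (1 + t))) := by gcongr; linarith
      _ ≤ (1 + H) ^ (1 : ℝ) := by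
        apply Real.rpow_le_rpow_of_exponent_le (by linarith)
        rw [mul_one_div, div_le_one h1t]; linarith
      _ = 1 + H := Real.rpow_one _
  have h5 : (c⁻¹) ^ (1 / (1 + t)) ≤ max 1 c⁻¹ := by
    calc (c⁻¹) ^ (1 / (1 + t)) ≤ (max 1 c⁻¹) ^ (1 / (1 + t)) := by
          gcongr; exact le_max_right _ _
      _ ≤ (max 1 c⁻¹) ^ (1 : ℝ) := Real.rpow_le_rpow_of_exponent_le (le_max_left _ _) hk1
      _ = _ := Real.rpow_one _
  have h6 : M / 2 ≤ X ^ (1 / (1 + t)) * ((1 + H) * max 1 c⁻¹) := h3.trans (by gcongr)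
  linarith

/-- The ball is centred halfway along the axis. A displacement `z` stays in the cone if `‖z‖ (1 +
cos θ) < (r/2)(1 - cos θ)`, which the radius guarantees since `1 + cos θ < 2`. -/
theorem ball_subset_finiteCone {N : ℕ} {x ξ : Eucl N} {θ r : ℝ} (hξ : ‖ξ‖ = 1) (hθ : 0 < θ)
    (hθ' : θ < Real.pi / 2) :
    Metric.ball (x + (r / 2) • ξ) ((1 - Real.cos θ) / 4 * r) ⊆ finiteCone x ξ θ r := by
  intro y hy
  have hc0 : 0 < Real.cos θ := Real.cos_pos_of_mem_Ioo ⟨by linarith, hθ'⟩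
  have hc1 : Real.cos θ < 1 := by
    have := Real.cos_lt_cos_of_nonneg_of_le_pi le_rfl (by linarith [Real.pi_pos]) hθ
    simpa using this
  rw [Metric.mem_ball, dist_eq_norm] at hy
  have hr : 0 < r := by
    have := (norm_nonneg _).trans_lt hy
    by_contra hr
    nlinarith
  set z := y - (x + (r / 2) • ξ) with hz
  have hyx : y - x = (r / 2) • ξ + z := by rw [hz]; abel
  have h1 : ‖y - x‖ ≤ r / 2 + ‖z‖ := by
    rw [hyx]
    refine (norm_add_le _ _).trans_eq ?_
    rw [norm_smul, hξ, Real.norm_of_nonneg (by positivity), mul_one]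
  have h2 : r / 2 - ‖z‖ ≤ inner ℝ (y - x) ξ := by
    rw [hyx, inner_add_left, real_inner_smul_left, real_inner_self_eq_norm_sq, hξ]
    have := abs_real_inner_le_norm z ξ
    rw [hξ, mul_one] at this
    have := neg_le_of_abs_le this
    linarith
  refine ⟨by nlinarith, ?_⟩
  calc ‖y - x‖ * Real.cos θ ≤ (r / 2 + ‖z‖) * Real.cos θ := by gcongr
    _ < r / 2 - ‖z‖ := by nlinarith [norm_nonneg z]
    _ ≤ _ := h2

theorem finiteCone_mono {N : ℕ} {x ξ : Eucl N} {θ r r' : ℝ} (h : r' ≤ r) :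
    finiteCone x ξ θ r' ⊆ finiteCone x ξ θ r :=
  fun _ hy => ⟨hy.1.trans_le h, hy.2⟩

/-- Interpolation of the sup norm between a Hölder seminorm and an `L^q` norm on a set with the
uniform interior cone condition, with a constant independent of the Hölder exponent. -/
theorem exists_eLpNorm_top_le_of_holder {N : ℕ} {Ω : Set (Eucl N)}
    (hcone : UniformInteriorCone Ω) (hΩ : IsOpen Ω) {q : ℝ} (hq : 1 ≤ q) :
    ∃ K : ℝ, 1 ≤ K ∧ ∀ β : ℝ≥0, 0 < β → ∀ (w : Eucl N → ℝ) (H : ℝ), 0 ≤ H →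
      (∀ x ∈ Ω, ∀ y ∈ Ω, |w x - w y| ≤ H * dist x y ^ (β : ℝ)) →
      (∀ᵐ x ∂volume.restrict Ω, |w x| ≤ H) →
      eLpNorm w ∞ (volume.restrict Ω) ≤ ENNReal.ofReal (K * (1 + H)) *
        eLpNorm w (ENNReal.ofReal q) (volume.restrict Ω) ^ kappa N β q := by
  obtain ⟨θ, r, hθ, hθ', hr, hc⟩ := hcone
  have hc1 : Real.cos θ < 1 := by
    have := Real.cos_lt_cos_of_nonneg_of_le_pi le_rfl (by linarith [Real.pi_pos]) hθ
    simpa using this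
  set δ := (1 - Real.cos θ) / 4 with hδ
  have hδ0 : 0 < δ := by rw [hδ]; linarith
  -- Capping at `1` gives `r₀ ^ β ≤ 1` for every `β`, so `c` below need not depend on `β`.
  set r₀ := min r 1 with hr₀
  have hr₀0 : 0 < r₀ := lt_min hr one_pos
  set v := (volume (Metric.ball (0 : Eucl N) 1)).toReal with hv
  have hv0 : 0 < v := ENNReal.toReal_pos (Metric.measure_ball_pos _ _ one_pos).ne'
    measure_ball_lt_top.ne
  have hq0 : 0 < q := by linarith
  set c := ((δ * r₀) ^ N * v) ^ (1 / q) with hcdef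
  have hcpos : 0 < c := by positivity
  refine ⟨2 * max 1 c⁻¹, by linarith [le_max_left 1 c⁻¹], ?_⟩
  intro β hβ w H hH hw hwH
  have hβ' : (0 : ℝ) < β := hβ
  have hk : 0 < kappa N β q := by unfold kappa; positivity
  set X := eLpNorm w (ENNReal.ofReal q) (volume.restrict Ω) with hX
  by_cases hXtop : X = ⊤
  · rw [hXtop, ENNReal.top_rpow_of_pos hk, ENNReal.mul_top]
    · exact le_top
    · rw [Ne, ENNReal.ofReal_eq_zero, not_le]; positivity
  rw [eLpNorm_exponent_top]
  refine essSup_le_of_ae_le _ ?_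
  filter_upwards [hwH, ae_restrict_mem hΩ.measurableSet] with x hxH hxΩ
  rcases (abs_nonneg (w x)).eq_or_lt with h0 | hM
  · rw [← Real.norm_eq_abs, eq_comm] at h0
    have : w x = 0 := norm_eq_zero.1 h0
    simp [this]
  set M := |w x| with hMdef
  have hHpos : 0 < H := hM.trans_le hxH
  set s := M / (2 * H) with hs
  have hs0 : 0 < s := by positivity
  have hs1 : s ≤ 1 := by rw [hs, div_le_one (by positivity)]; linarith
  -- The radius is chosen so that `H ρ^β ≤ M / 2`: within distance `ρ` of `x`, `|w|` cannot drop
  -- below `M / 2`.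
  set ρ := r₀ * s ^ (1 / (β : ℝ)) with hρ
  have hρ0 : 0 < ρ := by positivity
  have hρr : ρ ≤ r := by
    have : s ^ (1 / (β : ℝ)) ≤ 1 := Real.rpow_le_one hs0.le hs1 (by positivity)
    calc ρ ≤ r₀ * 1 := by rw [hρ]; gcongr
      _ ≤ r := by rw [mul_one]; exact min_le_left _ _
  have hρβ : ρ ^ (β : ℝ) ≤ s := by
    rw [hρ, Real.mul_rpow hr₀0.le (by positivity), ← Real.rpow_mul hs0.le,
      one_div_mul_cancel hβ'.ne', Real.rpow_one]
    have : r₀ ^ (β : ℝ) ≤ 1 := Real.rpow_le_one hr₀0.le (min_le_right _ _) hβ'.le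
    nlinarith
  obtain ⟨ξ, hξ, hξΩ⟩ := hc x hxΩ
  set B := Metric.ball (x + (ρ / 2) • ξ) (δ * ρ) with hB
  have hBc : B ⊆ finiteCone x ξ θ ρ := ball_subset_finiteCone hξ hθ hθ'
  have hBΩ : B ⊆ Ω := hBc.trans ((finiteCone_mono hρr).trans hξΩ)
  have hBw : ∀ y ∈ B, M / 2 ≤ |w y| := by
    intro y hy
    have h1 := hw x hxΩ y (hBΩ hy)
    have h2 : dist x y ≤ ρ := by rw [dist_comm, dist_eq_norm]; exact (hBc hy).1.le
    have h3 : dist x y ^ (β : ℝ) ≤ s := (Real.rpow_le_rpow dist_nonneg h2 hβ'.le).trans hρβ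
    have h4 : H * dist x y ^ (β : ℝ) ≤ M / 2 := by
      calc _ ≤ H * s := by gcongr
        _ = M / 2 := by rw [hs]; field_simp
    have h5 := abs_sub_abs_le_abs_sub (w x) (w y)
    rw [← hMdef] at h5
    linarith
  have hq' : ENNReal.ofReal q ≠ 0 := by simpa using hq0
  have hlow : ENNReal.ofReal (M / 2) * (volume B) ^ (1 / q) ≤ X := by
    have h1 := eLpNorm_indicator_const (μ := volume.restrict Ω) (c := M / 2)
      (p := ENNReal.ofReal q) (s := B) Metric.isOpen_ball.measurableSet hq' ENNReal.ofReal_ne_top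
    rw [ENNReal.toReal_ofReal hq0.le, Measure.restrict_apply Metric.isOpen_ball.measurableSet,
      inter_eq_self_of_subset_left hBΩ, Real.enorm_of_nonneg (by positivity)] at h1
    rw [← h1]
    refine eLpNorm_mono fun y => ?_
    by_cases hy : y ∈ B
    · rw [indicator_of_mem hy, Real.norm_of_nonneg (by positivity)]
      exact hBw y hy
    · rw [indicator_of_notMem hy, norm_zero]; positivity
  have hvol : volume B = ENNReal.ofReal ((δ * ρ) ^ N * v) := by
    rw [hB, Measure.addHaar_ball_of_pos _ _ (by positivity), finrank_euclideanSpace_fin,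
      ENNReal.ofReal_mul (by positivity), hv, ENNReal.ofReal_toReal measure_ball_lt_top.ne]
  have hreal : M / 2 * (c * s ^ ((N : ℝ) / (β * q))) ≤ X.toReal := by
    have h1 : ((δ * ρ) ^ N * v) ^ (1 / q) = c * s ^ ((N : ℝ) / (β * q)) := by
      have : (δ * ρ) ^ N * v = ((δ * r₀) ^ N * v) * (s ^ (1 / (β : ℝ))) ^ N := by
        rw [hρ, ← mul_assoc, mul_pow]; ring
      rw [this, Real.mul_rpow (by positivity) (by positivity), ← hcdef, ← Real.rpow_natCast,
        ← Real.rpow_mul hs0.le, ← Real.rpow_mul hs0.le]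
      congr 2
      field_simp
    rw [hvol, ENNReal.ofReal_rpow_of_nonneg (by positivity) (by positivity), h1,
      ← ENNReal.ofReal_mul (by positivity)] at hlow
    exact (ENNReal.ofReal_le_iff_le_toReal hXtop).1 hlow
  have hfin := le_rpow_of_mul_rpow_le hM hHpos hcpos (by positivity) hreal
  have hkap : kappa N β q = 1 / (1 + (N : ℝ) / (β * q)) := by
    unfold kappa; field_simp
  rw [← hkap] at hfin
  calc ‖w x‖ₑ = ENNReal.ofReal M := by rw [← ofReal_norm, Real.norm_eq_abs]
    _ ≤ ENNReal.ofReal (2 * max 1 c⁻¹ * (1 + H) * X.toReal ^ kappa N β q) :=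
        ENNReal.ofReal_le_ofReal hfin
    _ = _ := by
        rw [ENNReal.ofReal_mul (by positivity), ← ENNReal.ofReal_rpow_of_nonneg
          ENNReal.toReal_nonneg hk.le, ENNReal.ofReal_toReal hXtop]

end Interpolation

/-! ### Sobolev and Poincaré inequalities for limits of test functions. -/

section Sobolev

theorem eLpNorm_le_eLpNorm_mul_of_support_subset {α F : Type*} [MeasurableSpace α]
    {μ : Measure α} [NormedAddCommGroup F] {f : α → F} {s : Set α} {a b : ℝ≥0∞}
    (hab : a ≤ b) (hf : AEStronglyMeasurable f μ) (hs : Function.support f ⊆ s) :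
    eLpNorm f a μ ≤ eLpNorm f b μ * μ s ^ (1 / a.toReal - 1 / b.toReal) := by
  have := eLpNorm_le_eLpNorm_mul_rpow_measure_univ (μ := μ.restrict s) hab hf.restrict
  rwa [eLpNorm_restrict_eq_of_support_subset hs, eLpNorm_restrict_eq_of_support_subset hs,
    Measure.restrict_apply_univ] at this

/-- The fundamental theorem of calculus, carried over from `ℝ`. Dimension one is separate because
the Sobolev range `1 ≤ t < N` is then empty. -/
theorem enorm_le_eLpNorm_one_fderiv {φ : Eucl 1 → ℝ} (hφ : ContDiff ℝ 1 φ)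
    (hc : HasCompactSupport φ) (x : Eucl 1) :
    ‖φ x‖ₑ ≤ eLpNorm (fderiv ℝ φ) 1 volume := by
  let I : ℝ ≃ₗᵢ[ℝ] Eucl 1 := (OrthonormalBasis.singleton (Fin 1) ℝ).repr
  have hI : ContDiff ℝ 1 (fun t => φ (I t)) := hφ.comp I.contDiff
  have hcI : HasCompactSupport (fun t => φ (I t)) :=
    hc.comp_homeomorph I.toHomeomorph
  have h1 := HasCompactSupport.enorm_le_lintegral_Ici_deriv hI hcI (I.symm x)
  simp only [LinearIsometryEquiv.apply_symm_apply] at h1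
  have hmp : MeasurePreserving I volume volume := I.measurePreserving
  have hmeas : Measurable fun y => ‖fderiv ℝ φ y‖ₑ :=
    (hφ.continuous_fderiv one_ne_zero).enorm.measurable
  calc ‖φ x‖ₑ ≤ ∫⁻ y in Iic (I.symm x), ‖deriv (fun t => φ (I t)) y‖ₑ := h1
    _ ≤ ∫⁻ y, ‖deriv (fun t => φ (I t)) y‖ₑ := setLIntegral_le_lintegral _ _
    _ ≤ ∫⁻ y, ‖fderiv ℝ φ (I y)‖ₑ := by
        refine lintegral_mono fun y => ?_
        have hd : HasDerivAt (fun t => φ (I t)) (fderiv ℝ φ (I y) (I 1)) y := by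
          have h2 : HasDerivAt (fun t => I t) (I 1) y :=
            (I.toContinuousLinearEquiv : ℝ →L[ℝ] Eucl 1).hasDerivAt
          exact ((hφ.differentiable one_ne_zero) (I y)).hasFDerivAt.comp_hasDerivAt y h2
        rw [hd.deriv]
        refine ((fderiv ℝ φ (I y)).le_opENorm _).trans_eq ?_
        rw [← ofReal_norm (I 1), I.norm_map]; simp
    _ = ∫⁻ y, ‖fderiv ℝ φ y‖ₑ := hmp.lintegral_comp hmeas
    _ = _ := eLpNorm_one_eq_lintegral_enorm.symm

theorem exists_eLpNorm_le_eLpNorm_fderiv_one_dim {S : Set (Eucl 1)}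
    (hS : Bornology.IsBounded S) {q : ℝ} :
    ∃ C : ℝ≥0, ∀ φ : Eucl 1 → ℝ, ContDiff ℝ 1 φ → Function.support φ ⊆ S →
      eLpNorm φ (ENNReal.ofReal q) volume ≤ C * eLpNorm (fderiv ℝ φ) 1 volume := by
  set e : ℝ := (ENNReal.ofReal q).toReal⁻¹
  have hv : volume S ^ e ≠ ⊤ := ENNReal.rpow_ne_top_of_nonneg (by positivity) hS.measure_lt_top.ne
  refine ⟨(volume S ^ e).toNNReal, fun φ hφ hs => ?_⟩
  have hc : HasCompactSupport φ :=
    HasCompactSupport.of_support_subset_isCompact hS.isCompact_closure (hs.trans subset_closure)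
  rw [ENNReal.coe_toNNReal hv, ← eLpNorm_restrict_eq_of_support_subset hs]
  have h2 : eLpNorm φ ∞ (volume.restrict S) ≤ eLpNorm (fderiv ℝ φ) 1 volume := by
    rw [eLpNorm_exponent_top]
    exact essSup_le_of_ae_le _ (Eventually.of_forall fun x => enorm_le_eLpNorm_one_fderiv hφ hc x)
  have h3 := eLpNorm_le_eLpNorm_mul_rpow_measure_univ (μ := volume.restrict S) (p := ENNReal.ofReal q)
    le_top hφ.continuous.aestronglyMeasurable
  rw [Measure.restrict_apply_univ] at h3
  refine h3.trans ?_
  rw [mul_comm]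
  simp only [ENNReal.toReal_top, div_zero, sub_zero, one_div]
  gcongr

/-- Sobolev and Poincaré inequalities for smooth functions supported in a fixed bounded set, for
all finite exponents in the subcritical range. -/
theorem exists_eLpNorm_le_eLpNorm_fderiv {N : ℕ} (hN : 1 ≤ N) {S : Set (Eucl N)}
    (hS : Bornology.IsBounded S) {s q : ℝ} (hs : 1 ≤ s) (hq : 1 ≤ q)
    (hsq : s⁻¹ - (N : ℝ)⁻¹ ≤ q⁻¹) :
    ∃ C : ℝ≥0, ∀ φ : Eucl N → ℝ, ContDiff ℝ 1 φ → Function.support φ ⊆ S →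
      eLpNorm φ (ENNReal.ofReal q) volume ≤
        C * eLpNorm (fderiv ℝ φ) (ENNReal.ofReal s) volume := by
  -- Hölder on the bounded support lets the gradient exponent be lowered from `s` to a convenient
  -- `t`.
  suffices h : ∃ t : ℝ, 1 ≤ t ∧ t ≤ s ∧ ∃ C : ℝ≥0, ∀ φ : Eucl N → ℝ, ContDiff ℝ 1 φ →
      Function.support φ ⊆ S → eLpNorm φ (ENNReal.ofReal q) volume ≤
        C * eLpNorm (fderiv ℝ φ) (ENNReal.ofReal t) volume by
    obtain ⟨t, ht, hts, C, hC⟩ := h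
    have ht0 : 0 < t := by linarith
    set V := volume (closure S) ^ (1 / (ENNReal.ofReal t).toReal - 1 / (ENNReal.ofReal s).toReal)
    have hV : V ≠ ⊤ := by
      refine ENNReal.rpow_ne_top_of_nonneg ?_ hS.closure.measure_lt_top.ne
      rw [ENNReal.toReal_ofReal (by linarith), ENNReal.toReal_ofReal (by linarith), sub_nonneg]
      gcongr
    refine ⟨C * V.toNNReal, fun φ hφ hφS => (hC φ hφ hφS).trans ?_⟩
    rw [ENNReal.coe_mul, ENNReal.coe_toNNReal hV, mul_assoc, mul_comm V]
    gcongr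
    refine eLpNorm_le_eLpNorm_mul_of_support_subset (ENNReal.ofReal_le_ofReal hts)
      (hφ.continuous_fderiv one_ne_zero).aestronglyMeasurable ?_
    exact (support_fderiv_subset ℝ).trans (closure_mono hφS)
  rcases hN.eq_or_lt with rfl | hN2
  · refine ⟨1, le_rfl, hs, ?_⟩
    simpa using exists_eLpNorm_le_eLpNorm_fderiv_one_dim hS (q := q)
  have hN0 : (2 : ℝ) ≤ N := by exact_mod_cast hN2
  have hq0 : 0 < q := by linarith
  obtain ⟨t, ht, hts, htN, htq⟩ : ∃ t : ℝ, 1 ≤ t ∧ t ≤ s ∧ t < N ∧ t⁻¹ - (N : ℝ)⁻¹ ≤ q⁻¹ := by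
    rcases lt_or_ge s N with hsN | hsN
    · exact ⟨s, hs, le_rfl, hsN, hsq⟩
    -- For `s ≥ N`, take `1/t = min 1 (1/N + 1/q)`: large enough to force `t < N`, and at most the
    -- Sobolev threshold for `q`.
    · have hτ : (N : ℝ)⁻¹ < min 1 ((N : ℝ)⁻¹ + q⁻¹) := by
        refine lt_min (inv_lt_one_of_one_lt₀ (by linarith)) ?_
        have : 0 < q⁻¹ := by positivity
        linarith
      have hτ0 : 0 < min 1 ((N : ℝ)⁻¹ + q⁻¹) := by positivity
      have hlt := inv_strictAnti₀ (by positivity) hτ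
      rw [inv_inv] at hlt
      refine ⟨(min 1 ((N : ℝ)⁻¹ + q⁻¹))⁻¹, ?_, hlt.le.trans hsN, hlt, ?_⟩
      · exact (one_le_inv₀ hτ0).2 (min_le_left _ _)
      · rw [inv_inv]
        linarith [min_le_right 1 ((N : ℝ)⁻¹ + q⁻¹)]
  refine ⟨t, ht, hts, eLpNormLESNormFDerivOfLeConst ℝ volume S t.toNNReal q.toNNReal,
    fun φ hφ hφS => ?_⟩
  have ht' : ((t.toNNReal : ℝ≥0) : ℝ) = t := Real.coe_toNNReal _ (by linarith)
  have hq' : ((q.toNNReal : ℝ≥0) : ℝ) = q := Real.coe_toNNReal _ (by linarith)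
  refine eLpNorm_le_eLpNorm_fderiv_of_le volume hφ hφS ?_ ?_ ?_ hS
  · rw [← NNReal.coe_le_coe, ht']; exact ht
  · rw [finrank_euclideanSpace_fin, ← NNReal.coe_lt_coe, ht']; exact htN
  · rw [finrank_euclideanSpace_fin, hq', NNReal.coe_inv, ht']; exact htq

theorem norm_gradient_eq {N : ℕ} (φ : Eucl N → ℝ) (x : Eucl N) :
    ‖gradient φ x‖ = ‖fderiv ℝ φ x‖ := by
  simp [gradient]

theorem inner_gradient_left_eq {N : ℕ} (φ : Eucl N → ℝ) (x v : Eucl N) :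
    inner ℝ (gradient φ x) v = fderiv ℝ φ x v := by
  simp [gradient]

theorem continuous_gradient {N : ℕ} {φ : Eucl N → ℝ} (h : ContDiff ℝ 1 φ) :
    Continuous (gradient φ) :=
  (InnerProductSpace.toDual ℝ (Eucl N)).symm.continuous.comp (h.continuous_fderiv one_ne_zero)

theorem support_gradient_subset {N : ℕ} (φ : Eucl N → ℝ) :
    Function.support (gradient φ) ⊆ tsupport φ := by
  intro x hx
  refine support_fderiv_subset ℝ (f := φ) ?_
  rwa [Function.mem_support, ← norm_ne_zero_iff, ← norm_gradient_eq, norm_ne_zero_iff]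

theorem IsTestFunction.contDiff_one {N : ℕ} {Ω : Set (Eucl N)} {φ : Eucl N → ℝ}
    (h : IsTestFunction Ω φ) : ContDiff ℝ 1 φ := h.1.of_le (by exact_mod_cast le_top)

theorem IsTestFunction.support_subset {N : ℕ} {Ω : Set (Eucl N)} {φ : Eucl N → ℝ}
    (h : IsTestFunction Ω φ) : Function.support φ ⊆ Ω := subset_closure.trans h.2.2

theorem IsTestFunction.hasCompactSupport_gradient {N : ℕ} {Ω : Set (Eucl N)} {φ : Eucl N → ℝ}
    (h : IsTestFunction Ω φ) : HasCompactSupport (gradient φ) :=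
  HasCompactSupport.of_support_subset_isCompact h.2.1 (support_gradient_subset φ)

theorem IsTestFunction.memLp_gradient {N : ℕ} {Ω : Set (Eucl N)} {φ : Eucl N → ℝ}
    (h : IsTestFunction Ω φ) (p : ℝ≥0∞) : MemLp (gradient φ) p (volume.restrict Ω) :=
  ((continuous_gradient h.contDiff_one).memLp_of_hasCompactSupport
    h.hasCompactSupport_gradient).restrict _

theorem IsTestFunction.memLp {N : ℕ} {Ω : Set (Eucl N)} {φ : Eucl N → ℝ}
    (h : IsTestFunction Ω φ) (p : ℝ≥0∞) : MemLp φ p (volume.restrict Ω) :=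
  (h.1.continuous.memLp_of_hasCompactSupport h.2.1).restrict _

theorem IsTestFunction.sub {N : ℕ} {Ω : Set (Eucl N)} {φ ψ : Eucl N → ℝ}
    (h : IsTestFunction Ω φ) (h' : IsTestFunction Ω ψ) : IsTestFunction Ω (φ - ψ) := by
  refine ⟨h.1.sub h'.1, h.2.1.sub h'.2.1, ?_⟩
  exact (tsupport_sub φ ψ).trans (union_subset h.2.2 h'.2.2)

theorem IsTestFunction.gradient_sub {N : ℕ} {Ω : Set (Eucl N)} {φ ψ : Eucl N → ℝ}
    (h : IsTestFunction Ω φ) (h' : IsTestFunction Ω ψ) :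
    gradient (φ - ψ) = gradient φ - gradient ψ := by
  ext1 x
  simp only [gradient, Pi.sub_apply]
  rw [fderiv_sub (h.contDiff_one.differentiable one_ne_zero x)
    (h'.contDiff_one.differentiable one_ne_zero x), map_sub]

/-- The pair `(u, G)` is the limit in `L^p(Ω)` of pairs `(φ n, ∇ (φ n))` of test functions. -/
def IsTestLimit {N : ℕ} (Ω : Set (Eucl N)) (p : ℝ) (u : Eucl N → ℝ) (G : Eucl N → Eucl N) :
    Prop :=
  MemLp u (ENNReal.ofReal p) (volume.restrict Ω) ∧
  MemLp G (ENNReal.ofReal p) (volume.restrict Ω) ∧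
  ∃ φ : ℕ → Eucl N → ℝ, (∀ n, IsTestFunction Ω (φ n)) ∧
    Tendsto (fun n => eLpNorm (φ n - u) (ENNReal.ofReal p) (volume.restrict Ω)) atTop (𝓝 0) ∧
    Tendsto (fun n => eLpNorm (gradient (φ n) - G) (ENNReal.ofReal p) (volume.restrict Ω))
      atTop (𝓝 0)

theorem MemSobolevZero.isTestLimit {N : ℕ} {Ω : Set (Eucl N)} {p : ℝ} {u : Eucl N → ℝ}
    {G : Eucl N → Eucl N} (h : MemSobolevZero Ω p u G) : IsTestLimit Ω p u G :=
  ⟨h.1, h.2.1, h.2.2.2⟩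

theorem tendsto_eLpNorm_sub_sub {α F : Type*} [MeasurableSpace α] {μ : Measure α}
    [NormedAddCommGroup F] {p : ℝ≥0∞} (hp : 1 ≤ p) {f g : ℕ → α → F} {u v : α → F}
    (hf : ∀ n, MemLp (f n) p μ) (hg : ∀ n, MemLp (g n) p μ) (hu : MemLp u p μ) (hv : MemLp v p μ)
    (h1 : Tendsto (fun n => eLpNorm (f n - u) p μ) atTop (𝓝 0))
    (h2 : Tendsto (fun n => eLpNorm (g n - v) p μ) atTop (𝓝 0)) :
    Tendsto (fun n => eLpNorm (f n - g n - (u - v)) p μ) atTop (𝓝 0) := by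
  have h3 := h1.add h2
  rw [add_zero] at h3
  refine tendsto_of_tendsto_of_tendsto_of_le_of_le tendsto_const_nhds h3 (fun _ => zero_le)
    fun n => ?_
  have : f n - g n - (u - v) = (f n - u) - (g n - v) := by abel
  rw [this]
  exact eLpNorm_sub_le ((hf n).1.sub hu.1) ((hg n).1.sub hv.1) hp

theorem IsTestLimit.sub {N : ℕ} {Ω : Set (Eucl N)} {p : ℝ} (hp : 1 ≤ p) {u v : Eucl N → ℝ}
    {G F : Eucl N → Eucl N} (h : IsTestLimit Ω p u G) (h' : IsTestLimit Ω p v F) :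
    IsTestLimit Ω p (u - v) (G - F) := by
  obtain ⟨hu, hG, φ, hφ, h1, h2⟩ := h
  obtain ⟨hv, hF, ψ, hψ, h3, h4⟩ := h'
  have hp' : 1 ≤ ENNReal.ofReal p := by simpa using hp
  refine ⟨hu.sub hv, hG.sub hF, fun n => φ n - ψ n, fun n => (hφ n).sub (hψ n), ?_, ?_⟩
  · exact tendsto_eLpNorm_sub_sub hp' (fun n => (hφ n).memLp _) (fun n => (hψ n).memLp _) hu hv h1 h3
  · simp only [(hφ _).gradient_sub (hψ _)]
    exact tendsto_eLpNorm_sub_sub hp' (fun n => (hφ n).memLp_gradient _)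
      (fun n => (hψ n).memLp_gradient _) hG hF h2 h4

/-- The gradient norms converge, and the `L^q` norm is lower semicontinuous under convergence in
measure, so no convergence in `L^q` is needed. -/
theorem exists_eLpNorm_le_of_isTestLimit {N : ℕ} (hN : 1 ≤ N) {Ω : Set (Eucl N)}
    (hbdd : Bornology.IsBounded Ω) {s q : ℝ} (hs : 1 ≤ s) (hq : 1 ≤ q)
    (hsq : s⁻¹ - (N : ℝ)⁻¹ ≤ q⁻¹) :
    ∃ C : ℝ≥0, ∀ (u : Eucl N → ℝ) (G : Eucl N → Eucl N), IsTestLimit Ω s u G →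
      eLpNorm u (ENNReal.ofReal q) (volume.restrict Ω) ≤
        C * eLpNorm G (ENNReal.ofReal s) (volume.restrict Ω) := by
  obtain ⟨C, hC⟩ := exists_eLpNorm_le_eLpNorm_fderiv hN hbdd hs hq hsq
  refine ⟨C, fun u G h => ?_⟩
  obtain ⟨hu, hG, φ, hφ, h1, h2⟩ := h
  have hs' : 1 ≤ ENNReal.ofReal s := by simpa using hs
  have hb : ∀ n, eLpNorm (φ n) (ENNReal.ofReal q) (volume.restrict Ω) ≤
      C * (eLpNorm (gradient (φ n) - G) (ENNReal.ofReal s) (volume.restrict Ω) +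
        eLpNorm G (ENNReal.ofReal s) (volume.restrict Ω)) := by
    intro n
    have h3 := hC (φ n) (hφ n).contDiff_one (hφ n).support_subset
    rw [← eLpNorm_restrict_eq_of_support_subset (hφ n).support_subset] at h3
    refine h3.trans ?_
    gcongr
    have h4 : eLpNorm (fderiv ℝ (φ n)) (ENNReal.ofReal s) volume =
        eLpNorm (gradient (φ n)) (ENNReal.ofReal s) (volume.restrict Ω) := by
      rw [eLpNorm_restrict_eq_of_support_subset ((support_gradient_subset _).trans (hφ n).2.2)]
      exact eLpNorm_congr_norm_ae (Eventually.of_forall fun x => (norm_gradient_eq _ _).symm)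
    rw [h4]
    have h5 := eLpNorm_add_le (((hφ n).memLp_gradient (ENNReal.ofReal s)).sub hG).1 hG.1 hs'
    simpa using h5
  have hlim : Tendsto (fun n => C * (eLpNorm (gradient (φ n) - G) (ENNReal.ofReal s)
      (volume.restrict Ω) + eLpNorm G (ENNReal.ofReal s) (volume.restrict Ω))) atTop
      (𝓝 (C * eLpNorm G (ENNReal.ofReal s) (volume.restrict Ω))) := by
    have := ENNReal.Tendsto.const_mul (a := (C : ℝ≥0∞)) (h2.add_const
      (eLpNorm G (ENNReal.ofReal s) (volume.restrict Ω))) (Or.inr ENNReal.coe_ne_top)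
    simpa using this
  refine le_of_forall_gt_imp_ge_of_dense fun b hb' => ?_
  refine eLpNorm_le_of_tendstoInMeasure (u := atTop) (f := φ) ?_ ?_ fun n => ((hφ n).memLp 1).1
  · filter_upwards [hlim.eventually_lt_const hb'] with n hn using (hb n).trans hn.le
  · exact tendstoInMeasure_of_tendsto_eLpNorm (p := ENNReal.ofReal s)
      (by simpa using (by linarith : 0 < s)) (fun n => ((hφ n).memLp 1).1) hu.1 h1

end Sobolev

/-! ### Extending the weak formulation to bounded elements of `W_0^{1,p}`. -/

section Testing

/-- A smooth, compactly supported function of one variable that is the identity on `(-M, M)`. -/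
theorem exists_smooth_truncation (M : ℝ) :
    ∃ T : ℝ → ℝ, ContDiff ℝ ∞ T ∧ T 0 = 0 ∧ (∃ C, ∀ t, ‖T t‖ ≤ C) ∧ (∃ C, ∀ t, ‖deriv T t‖ ≤ C) ∧
      ∀ t, |t| < M → T t = t ∧ deriv T t = 1 := by
  let χ : ContDiffBump (0 : ℝ) :=
    { rIn := |M| + 1, rOut := |M| + 2, rIn_pos := by positivity, rIn_lt_rOut := by linarith }
  have hχ : ContDiff ℝ ∞ χ := χ.contDiff
  have hT : ContDiff ℝ ∞ (fun t => t * χ t) := contDiff_id.mul hχ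
  have hs : HasCompactSupport (fun t => t * χ t) := χ.hasCompactSupport.mul_left
  refine ⟨fun t => t * χ t, hT, by simp, hT.continuous.bounded_above_of_compact_support hs,
    (hT.continuous_deriv (by simp)).bounded_above_of_compact_support hs.deriv, fun t ht => ?_⟩
  have hball : t ∈ Metric.ball (0 : ℝ) χ.rIn := by
    rw [Metric.mem_ball, dist_zero_right, Real.norm_eq_abs]
    exact ht.trans_le ((le_abs_self M).trans (by simp [χ]))
  have he : (fun t => t * χ t) =ᶠ[𝓝 t] id := by
    filter_upwards [χ.eventuallyEq_one_of_mem_ball hball] with s hs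
    simp [hs]
  exact ⟨he.eq_of_nhds, by rw [he.deriv_eq, deriv_id]⟩

theorem IsTestFunction.comp_left {N : ℕ} {Ω : Set (Eucl N)} {φ : Eucl N → ℝ}
    (h : IsTestFunction Ω φ) {T : ℝ → ℝ} (hT : ContDiff ℝ ∞ T) (hT0 : T 0 = 0) :
    IsTestFunction Ω (fun x => T (φ x)) := by
  refine ⟨hT.comp h.1, h.2.1.comp_left hT0, ?_⟩
  refine (closure_mono fun x hx => ?_).trans h.2.2
  intro h0
  exact hx (by simp [h0, hT0])

theorem IsTestFunction.gradient_comp_left {N : ℕ} {Ω : Set (Eucl N)} {φ : Eucl N → ℝ}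
    (h : IsTestFunction Ω φ) {T : ℝ → ℝ} (hT : ContDiff ℝ ∞ T) (x : Eucl N) :
    gradient (fun x => T (φ x)) x = deriv T (φ x) • gradient φ x := by
  have h1 : HasFDerivAt φ (fderiv ℝ φ x) x :=
    (h.contDiff_one.differentiable one_ne_zero x).hasFDerivAt
  have h2 : HasDerivAt T (deriv T (φ x)) (φ x) :=
    (hT.differentiable (by simp) (φ x)).hasDerivAt
  have h3 := h2.comp_hasFDerivAt x h1
  have h4 : fderiv ℝ (fun x => T (φ x)) x = deriv T (φ x) • fderiv ℝ φ x := h3.fderiv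
  simp only [gradient]
  rw [h4, LinearIsometryEquiv.map_smulₛₗ]
  simp

theorem eLpNorm_inner_le {α F : Type*} [MeasurableSpace α] {μ : Measure α} [NormedAddCommGroup F]
    [InnerProductSpace ℝ F] {f g : α → F} {p q : ℝ≥0∞} [ENNReal.HolderConjugate p q]
    (hf : AEStronglyMeasurable f μ) (hg : AEStronglyMeasurable g μ) :
    eLpNorm (fun x => inner ℝ (f x) (g x) : α → ℝ) 1 μ ≤ eLpNorm f p μ * eLpNorm g q μ := by
  have := eLpNorm_le_eLpNorm_mul_eLpNorm'_of_norm (p := p) (q := q) (r := 1) hf hg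
    (fun a b => (inner ℝ a b : ℝ)) 1
    (Eventually.of_forall fun x => by simpa using norm_inner_le_norm (𝕜 := ℝ) (f x) (g x))
  simpa using this

theorem integrable_inner_of_memLp {α F : Type*} [MeasurableSpace α] {μ : Measure α}
    [NormedAddCommGroup F] [InnerProductSpace ℝ F] {f g : α → F} {p q : ℝ≥0∞}
    [ENNReal.HolderConjugate p q] (hf : MemLp f p μ) (hg : MemLp g q μ) :
    Integrable (fun x => inner ℝ (f x) (g x) : α → ℝ) μ :=
  memLp_one_iff_integrable.1 ⟨hf.1.inner hg.1,
    (eLpNorm_inner_le (p := p) (q := q) hf.1 hg.1).trans_lt (ENNReal.mul_lt_top hf.2 hg.2)⟩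

theorem enorm_integral_inner_le {α F : Type*} [MeasurableSpace α] {μ : Measure α}
    [NormedAddCommGroup F] [InnerProductSpace ℝ F] {f g : α → F} {p q : ℝ≥0∞}
    [ENNReal.HolderConjugate p q] (hf : AEStronglyMeasurable f μ)
    (hg : AEStronglyMeasurable g μ) :
    ‖∫ x, inner ℝ (f x) (g x) ∂μ‖ₑ ≤ eLpNorm f p μ * eLpNorm g q μ := by
  refine (enorm_integral_le_lintegral_enorm _).trans ?_
  rw [← eLpNorm_one_eq_lintegral_enorm]
  exact eLpNorm_inner_le hf hg

/-- A weak formulation against test functions extends to bounded elements of `W_0^{1,p}`. -/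
theorem integral_inner_eq_of_isTestLimit {N : ℕ} {Ω : Set (Eucl N)} {p : ℝ} {p' : ℝ≥0∞}
    (hp : 1 < p) [ENNReal.HolderConjugate p' (ENNReal.ofReal p)] {A : Eucl N → Eucl N}
    {a : Eucl N → ℝ} (hA : MemLp A p' (volume.restrict Ω)) (ha : Integrable a (volume.restrict Ω))
    (heq : ∀ φ : Eucl N → ℝ, IsTestFunction Ω φ →
      ∫ x in Ω, inner ℝ (A x) (gradient φ x) = ∫ x in Ω, a x * φ x)
    {w : Eucl N → ℝ} {G : Eucl N → Eucl N} (hw : IsTestLimit Ω p w G) {M : ℝ}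
    (hM : ∀ᵐ x ∂volume.restrict Ω, |w x| < M) :
    ∫ x in Ω, inner ℝ (A x) (G x) = ∫ x in Ω, a x * w x := by
  obtain ⟨hwp, hGp, φ, hφ, h1, h2⟩ := hw
  -- Since `a` is only integrable, the approximants must be uniformly bounded: `T ∘ φ n` is tested
  -- instead of `φ n`, and `T w = w` almost everywhere.
  obtain ⟨T, hT, hT0, ⟨C₁, hC₁⟩, ⟨C₂, hC₂⟩, hTM⟩ := exists_smooth_truncation M
  have hp0 : ENNReal.ofReal p ≠ 0 := by simpa using (by linarith : 0 < p)
  obtain ⟨ns, hns, hae⟩ := (tendstoInMeasure_of_tendsto_eLpNorm hp0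
    (fun n => ((hφ n).memLp 1).1) hwp.1 h1).exists_seq_tendsto_ae
  have hT' : Continuous (deriv T) := hT.continuous_deriv (by simp)
  have hR : Tendsto (fun n => ∫ x in Ω, a x * T (φ (ns n) x)) atTop (𝓝 (∫ x in Ω, a x * w x)) := by
    refine tendsto_integral_of_dominated_convergence (fun x => ‖a x‖ * C₁) (fun n => ?_)
      (ha.norm.mul_const _) (fun n => Eventually.of_forall fun x => ?_) ?_
    · exact ha.1.mul (hT.continuous.comp (hφ _).1.continuous).aestronglyMeasurable
    · rw [norm_mul]; gcongr; exact hC₁ _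
    · filter_upwards [hae, hM] with x hx hxM
      have h3 := (hT.continuous.tendsto (w x)).comp hx
      rw [(hTM _ hxM).1] at h3
      exact h3.const_mul _
  have hAG : Integrable (fun x => inner ℝ (A x) (G x) : Eucl N → ℝ) (volume.restrict Ω) :=
    integrable_inner_of_memLp (p := p') (q := ENNReal.ofReal p) hA hGp
  have hmeas : ∀ n, AEStronglyMeasurable (fun x => deriv T (φ n x)) (volume.restrict Ω) :=
    fun n => (hT'.comp (hφ n).1.continuous).aestronglyMeasurable
  -- Split `∇(T ∘ φ) = T'(φ) G + T'(φ) (∇φ - G)`. The first part converges by domination, because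
  -- `T'(w) = 1`; the second (`hL1`) vanishes by Hölder.
  have hL2 : Tendsto (fun n => ∫ x in Ω, deriv T (φ (ns n) x) * inner ℝ (A x) (G x)) atTop
      (𝓝 (∫ x in Ω, inner ℝ (A x) (G x))) := by
    refine tendsto_integral_of_dominated_convergence (fun x => C₂ * ‖(inner ℝ (A x) (G x) : ℝ)‖)
      (fun n => ?_) (hAG.norm.const_mul _) (fun n => Eventually.of_forall fun x => ?_) ?_
    · exact (hmeas _).mul hAG.1
    · rw [norm_mul]; gcongr; exact hC₂ _
    · filter_upwards [hae, hM] with x hx hxM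
      have h3 := (hT'.tendsto (w x)).comp hx
      rw [(hTM _ hxM).2] at h3
      simpa using h3.mul_const (inner ℝ (A x) (G x))
  have hC₂0 : 0 ≤ C₂ := (norm_nonneg _).trans (hC₂ 0)
  have hint : ∀ n, Integrable (fun x => inner ℝ (A x) (deriv T (φ n x) • (gradient (φ n) - G) x))
      (volume.restrict Ω) := fun n => by
    simp only [inner_smul_right]
    refine (integrable_inner_of_memLp (p := p') (q := ENNReal.ofReal p) hA
      (((hφ n).memLp_gradient _).sub hGp)).bdd_mul (hmeas n) (c := C₂)
      (Eventually.of_forall fun x => hC₂ _)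
  have hL1 : Tendsto (fun n => ∫ x in Ω, inner ℝ (A x)
      (deriv T (φ (ns n) x) • (gradient (φ (ns n)) - G) x)) atTop (𝓝 0) := by
    rw [tendsto_zero_iff_enorm_tendsto_zero]
    have hlim : Tendsto (fun n => eLpNorm A p' (volume.restrict Ω) * (ENNReal.ofReal C₂ *
        eLpNorm (gradient (φ (ns n)) - G) (ENNReal.ofReal p) (volume.restrict Ω))) atTop (𝓝 0) := by
      have h3 := h2.comp hns.tendsto_atTop
      have h4 := ENNReal.Tendsto.const_mul (a := ENNReal.ofReal C₂) h3 (Or.inr ENNReal.ofReal_ne_top)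
      have h5 := ENNReal.Tendsto.const_mul h4 (Or.inr hA.2.ne)
      simpa using h5
    refine tendsto_of_tendsto_of_tendsto_of_le_of_le tendsto_const_nhds hlim (fun _ => zero_le)
      fun n => ?_
    refine (enorm_integral_inner_le (p := p') (q := ENNReal.ofReal p) hA.1
      ((hmeas (ns n)).smul (((hφ _).memLp_gradient 1).1.sub hGp.1))).trans ?_
    gcongr
    refine eLpNorm_le_mul_eLpNorm_of_ae_le_mul (Eventually.of_forall fun x => ?_) _
    rw [Pi.smul_apply', norm_smul]
    gcongr
    exact hC₂ _
  have hL := hL1.add hL2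
  rw [zero_add] at hL
  refine tendsto_nhds_unique hL (hR.congr fun n => ?_)
  rw [← heq _ ((hφ (ns n)).comp_left hT hT0), ← integral_add (hint _)]
  · refine integral_congr_ae (Eventually.of_forall fun x => ?_)
    simp only [(hφ (ns n)).gradient_comp_left hT, inner_smul_right, Pi.sub_apply, inner_sub_right]
    ring
  · exact hAG.bdd_mul (hmeas _) (c := C₂) (Eventually.of_forall fun x => hC₂ _)

/-- The field has norm `‖G‖^(p-1)`, also where `G = 0`, so it lies in the dual exponent and pairs
with gradients in `L^p`. -/
theorem memLp_rpow_smul {α F : Type*} [MeasurableSpace α] {μ : Measure α} [NormedAddCommGroup F]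
    [NormedSpace ℝ F] {p : ℝ} (hp : 1 < p) {G : α → F} (hG : MemLp G (ENNReal.ofReal p) μ) :
    MemLp (fun x => ‖G x‖ ^ (p - 2) • G x) (ENNReal.ofReal (p / (p - 1))) μ := by
  have hp1 : 0 < p - 1 := by linarith
  have h1 := hG.norm_rpow_div (ENNReal.ofReal (p - 1))
  rw [← ENNReal.ofReal_div_of_pos hp1, ENNReal.toReal_ofReal hp1.le] at h1
  refine h1.congr_norm ((hG.1.norm.aemeasurable.pow_const _).aestronglyMeasurable.smul hG.1)
    (Eventually.of_forall fun x => ?_)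
  rcases (norm_nonneg (G x)).eq_or_lt with h0 | h0
  · simp [← h0, Real.zero_rpow hp1.ne', norm_smul]
  · rw [norm_smul, Real.norm_of_nonneg (by positivity), Real.norm_of_nonneg (by positivity),
      ← Real.rpow_add_one h0.ne']
    ring_nf

/-- Testing the difference of two equations with the difference of their solutions. -/
theorem integral_inner_sub_eq_of_isTestLimit {N : ℕ} {Ω : Set (Eucl N)} {p : ℝ} (hp : 1 < p)
    {a₁ a₂ u₁ u₂ : Eucl N → ℝ} {G₁ G₂ : Eucl N → Eucl N}
    (ha₁ : Integrable a₁ (volume.restrict Ω)) (ha₂ : Integrable a₂ (volume.restrict Ω))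
    (h₁ : IsTestLimit Ω p u₁ G₁) (h₂ : IsTestLimit Ω p u₂ G₂)
    (heq₁ : ∀ φ : Eucl N → ℝ, IsTestFunction Ω φ →
      ∫ x in Ω, ‖G₁ x‖ ^ (p - 2) * inner ℝ (G₁ x) (gradient φ x) = ∫ x in Ω, a₁ x * φ x)
    (heq₂ : ∀ φ : Eucl N → ℝ, IsTestFunction Ω φ →
      ∫ x in Ω, ‖G₂ x‖ ^ (p - 2) * inner ℝ (G₂ x) (gradient φ x) = ∫ x in Ω, a₂ x * φ x)
    {M : ℝ} (hM : ∀ᵐ x ∂volume.restrict Ω, |(u₁ - u₂) x| < M) :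
    Integrable (fun x => inner ℝ (‖G₁ x‖ ^ (p - 2) • G₁ x - ‖G₂ x‖ ^ (p - 2) • G₂ x)
      ((G₁ - G₂) x) : Eucl N → ℝ) (volume.restrict Ω) ∧
    ∫ x in Ω, inner ℝ (‖G₁ x‖ ^ (p - 2) • G₁ x - ‖G₂ x‖ ^ (p - 2) • G₂ x) ((G₁ - G₂) x) =
      ∫ x in Ω, (a₁ x - a₂ x) * (u₁ - u₂) x := by
  have : ENNReal.HolderConjugate (ENNReal.ofReal (p / (p - 1))) (ENNReal.ofReal p) :=
    ((Real.holderConjugate_iff_eq_conjExponent hp).2 rfl).symm.ennrealOfReal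
  have hA₁ := memLp_rpow_smul hp h₁.2.1
  have hA₂ := memLp_rpow_smul hp h₂.2.1
  have hw := h₁.sub hp.le h₂
  have e₁ := integral_inner_eq_of_isTestLimit hp hA₁ ha₁
    (by simpa only [real_inner_smul_left] using heq₁) hw hM
  have e₂ := integral_inner_eq_of_isTestLimit hp hA₂ ha₂
    (by simpa only [real_inner_smul_left] using heq₂) hw hM
  have hi₁ := integrable_inner_of_memLp hA₁ hw.2.1
  have hi₂ := integrable_inner_of_memLp hA₂ hw.2.1
  have hb : ∀ a : Eucl N → ℝ, Integrable a (volume.restrict Ω) →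
      Integrable (fun x => a x * (u₁ - u₂) x) (volume.restrict Ω) := fun a ha =>
    ha.mul_bdd hw.1.1 (hM.mono fun x hx => hx.le)
  simp only [inner_sub_left, sub_mul]
  refine ⟨hi₁.sub hi₂, ?_⟩
  rw [integral_sub hi₁ hi₂, integral_sub (hb _ ha₁) (hb _ ha₂), ← e₁, ← e₂]

end Testing

/-! ### Mollifying the zero extension to change the gradient exponent. -/

section Mollification

open scoped Convolution Pointwise

theorem tendsto_integral_inner {α F : Type*} [MeasurableSpace α] {μ : Measure α}
    [NormedAddCommGroup F] [InnerProductSpace ℝ F] {p q : ℝ≥0∞} [ENNReal.HolderConjugate p q]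
    {f : ℕ → α → F} {f₀ g : α → F} (hf : ∀ n, MemLp (f n) p μ) (hf₀ : MemLp f₀ p μ)
    (hg : MemLp g q μ) (h : Tendsto (fun n => eLpNorm (f n - f₀) p μ) atTop (𝓝 0)) :
    Tendsto (fun n => ∫ x, inner ℝ (f n x) (g x) ∂μ) atTop (𝓝 (∫ x, inner ℝ (f₀ x) (g x) ∂μ)) := by
  rw [← tendsto_sub_nhds_zero_iff, tendsto_zero_iff_enorm_tendsto_zero]
  have hlim := ENNReal.Tendsto.mul_const (b := eLpNorm g q μ) h (Or.inr hg.2.ne)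
  rw [zero_mul] at hlim
  refine tendsto_of_tendsto_of_tendsto_of_le_of_le tendsto_const_nhds hlim (fun _ => zero_le)
    fun n => ?_
  have := enorm_integral_inner_le (p := p) (q := q) ((hf n).1.sub hf₀.1) hg.1
  simp only [Pi.sub_apply, inner_sub_left] at this
  rwa [integral_sub (integrable_inner_of_memLp (hf n) hg) (integrable_inner_of_memLp hf₀ hg)]
    at this

/-- The extension by zero of an element of `W_0^{1,p}(Ω)` has the extension by zero of the gradient
as its weak gradient on the whole space. -/
theorem IsTestLimit.integral_mul_fderiv_eq {N : ℕ} {Ω : Set (Eucl N)} {p : ℝ} (hp : 1 < p)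
    {u : Eucl N → ℝ} {G : Eucl N → Eucl N} (h : IsTestLimit Ω p u G) {ψ : Eucl N → ℝ}
    (hψ : ContDiff ℝ 1 ψ) (hc : HasCompactSupport ψ) (v : Eucl N) :
    ∫ x in Ω, u x * fderiv ℝ ψ x v = -∫ x in Ω, ψ x * inner ℝ (G x) v := by
  have : ENNReal.HolderConjugate (ENNReal.ofReal p) (ENNReal.ofReal (p / (p - 1))) :=
    ((Real.holderConjugate_iff_eq_conjExponent hp).2 rfl).ennrealOfReal
  obtain ⟨hu, hG, φ, hφ, h1, h2⟩ := h
  have hdψ : Continuous fun x => fderiv ℝ ψ x v := hψ.continuous_fderiv_apply one_ne_zero |>.comp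
    (continuous_id.prodMk continuous_const)
  have hdc : HasCompactSupport fun x => fderiv ℝ ψ x v := hc.fderiv_apply ℝ v
  have l1 := tendsto_integral_inner (p := ENNReal.ofReal p) (q := ENNReal.ofReal (p / (p - 1)))
    (fun n => (hφ n).memLp (ENNReal.ofReal p)) hu
    ((hdψ.memLp_of_hasCompactSupport hdc).restrict Ω) h1
  have l2 := tendsto_integral_inner (p := ENNReal.ofReal p) (q := ENNReal.ofReal (p / (p - 1)))
    (fun n => (hφ n).memLp_gradient (ENNReal.ofReal p)) hG
    (((hψ.continuous.smul continuous_const).memLp_of_hasCompactSupport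
      (f := fun x => ψ x • v) hc.smul_right).restrict Ω) h2
  simp only [inner_smul_right, inner_gradient_left_eq] at l2
  simp only [RCLike.inner_apply, conj_trivial, mul_comm (fderiv ℝ ψ _ v)] at l1
  refine tendsto_nhds_unique l1 (l2.neg.congr fun n => ?_)
  have hφ1 := (hφ n).contDiff_one
  have hdφ : Continuous fun x => fderiv ℝ (φ n) x v := hφ1.continuous_fderiv_apply one_ne_zero |>.comp
    (continuous_id.prodMk continuous_const)
  have key := integral_mul_fderiv_eq_neg_fderiv_mul_of_integrable (μ := volume) (f := φ n) (g := ψ)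
    (v := v) ((hdφ.mul hψ.continuous).integrable_of_hasCompactSupport hc.mul_left)
    ((hφ1.continuous.mul hdψ).integrable_of_hasCompactSupport hdc.mul_left)
    ((hφ1.continuous.mul hψ.continuous).integrable_of_hasCompactSupport hc.mul_left)
    (fun x _ => hφ1.differentiable one_ne_zero x) (fun x _ => hψ.differentiable one_ne_zero x)
  rw [setIntegral_eq_integral_of_forall_compl_eq_zero (f := fun x => φ n x * fderiv ℝ ψ x v), key,
    setIntegral_eq_integral_of_forall_compl_eq_zero]
  · simp only [mul_comm]
  · intro x hx
    have : gradient (φ n) x = 0 := by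
      by_contra h0
      exact hx ((hφ n).2.2 (support_gradient_subset _ h0))
    rw [← inner_gradient_left_eq, this]; simp
  · intro x hx
    have : φ n x = 0 := by
      by_contra h0
      exact hx ((hφ n).support_subset h0)
    rw [this, zero_mul]

/-- The derivative of a mollification of the extension by zero is the mollification of the extension
by zero of the weak gradient. -/
theorem IsTestLimit.fderiv_convolution_apply {N : ℕ} {Ω : Set (Eucl N)} (hΩ : MeasurableSet Ω)
    {p : ℝ} (hp : 1 < p) {u : Eucl N → ℝ} {G : Eucl N → Eucl N} (h : IsTestLimit Ω p u G)
    (hu : Integrable u (volume.restrict Ω)) (hG : Integrable G (volume.restrict Ω))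
    {ρ : Eucl N → ℝ} (hρ : ContDiff ℝ 1 ρ) (hc : HasCompactSupport ρ) (x v : Eucl N) :
    fderiv ℝ (ρ ⋆[ContinuousLinearMap.lsmul ℝ ℝ, volume] Ω.indicator u) x v =
      inner ℝ ((ρ ⋆[ContinuousLinearMap.lsmul ℝ ℝ, volume] Ω.indicator G) x) v := by
  have hu' : Integrable (Ω.indicator u) := (integrable_indicator_iff hΩ).2 hu
  have hG' : Integrable (Ω.indicator G) := (integrable_indicator_iff hΩ).2 hG
  rw [(hc.hasFDerivAt_convolution_left (ContinuousLinearMap.lsmul ℝ ℝ) hρ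
    hu'.locallyIntegrable x).fderiv]
  set L := (ContinuousLinearMap.lsmul ℝ ℝ : ℝ →L[ℝ] ℝ →L[ℝ] ℝ)
  have hex := ((hc.fderiv ℝ).convolutionExists_left (L.precompL (Eucl N))
    (hρ.continuous_fderiv one_ne_zero) hu'.locallyIntegrable x).integrable_swap
  have hexG := (hc.convolutionExists_left (ContinuousLinearMap.lsmul ℝ ℝ) hρ.continuous
    hG'.locallyIntegrable x).integrable_swap
  simp only [ContinuousLinearMap.lsmul_apply] at hexG
  rw [convolution_eq_swap, ContinuousLinearMap.integral_apply hex, convolution_lsmul_swap,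
    real_inner_comm, ← integral_inner hexG]
  -- The reflected kernel need not be supported in `Ω`; the zero boundary values of `u` make it
  -- admissible. The sign from the reflection cancels that of integration by parts.
  have hψ : ContDiff ℝ 1 fun t => ρ (x - t) := hρ.comp (contDiff_const.sub contDiff_id)
  have hcψ : HasCompactSupport fun t => ρ (x - t) := hc.comp_homeomorph (Homeomorph.subLeft x)
  have hd : ∀ t, fderiv ℝ (fun t => ρ (x - t)) t v = -fderiv ℝ ρ (x - t) v := by
    intro t
    have h1 : HasFDerivAt (fun t => x - t) (-ContinuousLinearMap.id ℝ (Eucl N)) t :=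
      (hasFDerivAt_id t).const_sub x
    have h2 := ((hρ.differentiable one_ne_zero (x - t)).hasFDerivAt).comp t h1
    have h3 : fderiv ℝ (fun t => ρ (x - t)) t = _ := h2.fderiv
    rw [h3]; simp
  have key := h.integral_mul_fderiv_eq hp hψ hcψ v
  simp only [hd, mul_neg, integral_neg, neg_inj] at key
  rw [← integral_indicator hΩ, ← integral_indicator hΩ] at key
  refine Eq.trans (integral_congr_ae (Eventually.of_forall fun t => ?_)) (key.trans
    (integral_congr_ae (Eventually.of_forall fun t => ?_)))
  · by_cases ht : t ∈ Ω <;> simp [ht, ContinuousLinearMap.precompL_apply, L, mul_comm]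
  · by_cases ht : t ∈ Ω <;> simp [ht, inner_smul_right, real_inner_comm]

theorem IsTestLimit.norm_fderiv_convolution {N : ℕ} {Ω : Set (Eucl N)} (hΩ : MeasurableSet Ω)
    {p : ℝ} (hp : 1 < p) {u : Eucl N → ℝ} {G : Eucl N → Eucl N} (h : IsTestLimit Ω p u G)
    (hu : Integrable u (volume.restrict Ω)) (hG : Integrable G (volume.restrict Ω))
    {ρ : Eucl N → ℝ} (hρ : ContDiff ℝ 1 ρ) (hc : HasCompactSupport ρ) (x : Eucl N) :
    ‖fderiv ℝ (ρ ⋆[ContinuousLinearMap.lsmul ℝ ℝ, volume] Ω.indicator u) x‖ =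
      ‖(ρ ⋆[ContinuousLinearMap.lsmul ℝ ℝ, volume] Ω.indicator G) x‖ := by
  rw [← norm_gradient_eq]
  congr 1
  refine ext_inner_right ℝ fun v => ?_
  rw [inner_gradient_left_eq, h.fderiv_convolution_apply hΩ hp hu hG hρ hc]

theorem norm_convolution_normed_le {N : ℕ} (χ : ContDiffBump (0 : Eucl N)) {g : Eucl N → Eucl N}
    {L : ℝ} (hg : ∀ᵐ x, ‖g x‖ ≤ L) (x : Eucl N) :
    ‖(χ.normed volume ⋆[ContinuousLinearMap.lsmul ℝ ℝ, volume] g) x‖ ≤ L := by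
  rw [convolution_lsmul_swap]
  have hint : Integrable (fun t => χ.normed volume (x - t)) :=
    χ.integrable_normed.comp_sub_left x
  calc ‖∫ t, χ.normed volume (x - t) • g t‖ ≤ ∫ t, χ.normed volume (x - t) * L := by
        refine norm_integral_le_of_norm_le (hint.mul_const L) ?_
        filter_upwards [hg] with t ht
        rw [norm_smul, Real.norm_of_nonneg (χ.nonneg_normed _)]
        gcongr
        exact χ.nonneg_normed _
    _ = L := by
        rw [integral_mul_const, integral_sub_left_eq_self (fun t => χ.normed volume t),
          χ.integral_normed, one_mul]

/-- Sobolev inequality for elements of `W_0^{1,p}(Ω)` whose gradient is bounded, with an exponent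
on the gradient unrelated to `p`. -/
theorem exists_eLpNorm_le_of_isTestLimit_of_memLp_top {N : ℕ} (hN : 1 ≤ N) {Ω : Set (Eucl N)}
    (hΩ : MeasurableSet Ω) (hbdd : Bornology.IsBounded Ω) {s q : ℝ} (hs : 1 ≤ s) (hq : 1 ≤ q)
    (hsq : s⁻¹ - (N : ℝ)⁻¹ ≤ q⁻¹) {p : ℝ} (hp : 1 < p) :
    ∃ C : ℝ≥0, ∀ (u : Eucl N → ℝ) (G : Eucl N → Eucl N), IsTestLimit Ω p u G →
      MemLp G ∞ (volume.restrict Ω) →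
      eLpNorm u (ENNReal.ofReal q) (volume.restrict Ω) ≤
        C * eLpNorm G (ENNReal.ofReal s) (volume.restrict Ω) := by
  set S : Set (Eucl N) := Metric.cthickening 1 Ω with hS
  have hSb : Bornology.IsBounded S := hbdd.cthickening
  obtain ⟨C, hC⟩ := exists_eLpNorm_le_eLpNorm_fderiv hN hSb hs hq hsq
  refine ⟨C, fun u G h hGtop => ?_⟩
  have : IsFiniteMeasure (volume.restrict Ω) := ⟨by simpa using hbdd.measure_lt_top⟩
  have hp' : 1 ≤ ENNReal.ofReal p := by simpa using hp.le
  have hs0 : 0 < s := by linarith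
  have hu := h.1.integrable hp'
  have hG := h.2.1.integrable hp'
  have hu' : Integrable (Ω.indicator u) := (integrable_indicator_iff hΩ).2 hu
  have hG' : Integrable (Ω.indicator G) := (integrable_indicator_iff hΩ).2 hG
  set L := (eLpNorm G ∞ (volume.restrict Ω)).toReal
  have hL : ∀ᵐ x, ‖Ω.indicator G x‖ ≤ L := by
    have h1 := ae_le_eLpNormEssSup (f := G) (μ := volume.restrict Ω)
    rw [← eLpNorm_exponent_top, ae_restrict_iff' hΩ] at h1
    filter_upwards [h1] with x hx
    by_cases hxΩ : x ∈ Ω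
    · rw [indicator_of_mem hxΩ]
      have := ENNReal.toReal_mono hGtop.2.ne (hx hxΩ)
      rwa [toReal_enorm] at this
    · rw [indicator_of_notMem hxΩ, norm_zero]
      exact ENNReal.toReal_nonneg
  -- Outer radii at most `1` keep all mollifications supported in `S`; comparable inner and outer
  -- radii give almost everywhere convergence.
  let χ : ℕ → ContDiffBump (0 : Eucl N) := fun n =>
    { rIn := 1 / ((n : ℝ) + 1) / 2, rOut := 1 / ((n : ℝ) + 1)
      rIn_pos := by positivity, rIn_lt_rOut := half_lt_self (by positivity) }
  have hrOut : Tendsto (fun n => (χ n).rOut) atTop (𝓝 0) := tendsto_one_div_add_atTop_nhds_zero_nat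
  have hrle : ∀ᶠ n in atTop, (χ n).rOut ≤ 2 * (χ n).rIn := Eventually.of_forall fun n => by
    simp only [χ]; linarith
  set f : ℕ → Eucl N → ℝ := fun n =>
    (χ n).normed volume ⋆[ContinuousLinearMap.lsmul ℝ ℝ, volume] Ω.indicator u with hf
  set g : ℕ → Eucl N → Eucl N := fun n =>
    (χ n).normed volume ⋆[ContinuousLinearMap.lsmul ℝ ℝ, volume] Ω.indicator G with hg
  have hρ : ∀ n, ContDiff ℝ 1 ((χ n).normed volume) := fun n => (χ n).contDiff_normed
  have hc : ∀ n, HasCompactSupport ((χ n).normed volume) := fun n => (χ n).hasCompactSupport_normed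
  have hball : ∀ n, Function.support ((χ n).normed volume) + Ω ⊆ S := by
    rintro n _ ⟨y, hy, z, hz, rfl⟩
    rw [(χ n).support_normed_eq, mem_ball_zero_iff] at hy
    refine Metric.mem_cthickening_of_dist_le _ z _ _ hz ?_
    rw [dist_eq_norm, add_sub_cancel_right]
    refine hy.le.trans ?_
    simp only [χ]
    rw [div_le_one (by positivity)]
    linarith [(Nat.cast_nonneg n : (0 : ℝ) ≤ n)]
  have hfS : ∀ n, Function.support (f n) ⊆ S := fun n =>
    (support_convolution_subset _).trans
      ((add_subset_add_left support_indicator_subset).trans (hball n))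
  have hgS : ∀ n, Function.support (g n) ⊆ S := fun n =>
    (support_convolution_subset _).trans
      ((add_subset_add_left support_indicator_subset).trans (hball n))
  have hfsm : ∀ n, ContDiff ℝ 1 (f n) := fun n =>
    (hc n).contDiff_convolution_left (n := 1) _ (hρ n) hu'.locallyIntegrable
  have hgc : ∀ n, Continuous (g n) := fun n =>
    (hc n).continuous_convolution_left _ (hρ n).continuous hG'.locallyIntegrable
  have hSob : ∀ n, eLpNorm (f n) (ENNReal.ofReal q) volume ≤
      C * eLpNorm (g n) (ENNReal.ofReal s) volume := fun n => by
    refine (hC (f n) (hfsm n) (hfS n)).trans_eq ?_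
    congr 1
    exact eLpNorm_congr_norm_ae (Eventually.of_forall fun x =>
      h.norm_fderiv_convolution hΩ hp hu hG (hρ n) (hc n) x)
  -- Dominated convergence: the mollified gradients are bounded by `L` on the bounded set `S`. This
  -- is where boundedness of `G` replaces integrability at the exponent `s`.
  have hlimg : Tendsto (fun n => eLpNorm (g n) (ENNReal.ofReal s) volume) atTop
      (𝓝 (eLpNorm (Ω.indicator G) (ENNReal.ofReal s) volume)) := by
    have hs' : ENNReal.ofReal s ≠ 0 := by simpa using hs0
    simp only [eLpNorm_eq_lintegral_rpow_enorm_toReal hs' ENNReal.ofReal_ne_top,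
      ENNReal.toReal_ofReal hs0.le]
    refine (ENNReal.continuous_rpow_const.tendsto _).comp ?_
    refine tendsto_lintegral_of_dominated_convergence
      (S.indicator fun _ => ENNReal.ofReal L ^ s) (fun n => ?_) (fun n => ?_) ?_ ?_
    · exact ((hgc n).enorm.measurable).pow_const _
    · refine Eventually.of_forall fun x => ?_
      by_cases hx : x ∈ S
      · rw [indicator_of_mem hx]
        refine ENNReal.rpow_le_rpow ?_ hs0.le
        rw [← ofReal_norm]
        exact ENNReal.ofReal_le_ofReal (norm_convolution_normed_le (χ n) hL x)
      · rw [indicator_of_notMem hx]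
        simp only [Function.notMem_support.1 fun h0 => hx (hgS n h0)]
        simp [hs0]
    · refine ((lintegral_indicator_const_le _ _).trans_lt (ENNReal.mul_lt_top
        (ENNReal.rpow_lt_top_of_nonneg hs0.le ENNReal.ofReal_ne_top) hSb.measure_lt_top)).ne
    · filter_upwards [ContDiffBump.ae_convolution_tendsto_right_of_locallyIntegrable hrOut hrle
        hG'.locallyIntegrable] with x hx
      exact (ENNReal.continuous_rpow_const.tendsto _).comp hx.enorm
  have hlim := ENNReal.Tendsto.const_mul (a := (C : ℝ≥0∞)) hlimg (Or.inr ENNReal.coe_ne_top)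
  rw [← eLpNorm_indicator_eq_eLpNorm_restrict hΩ, ← eLpNorm_indicator_eq_eLpNorm_restrict hΩ]
  refine le_of_forall_gt_imp_ge_of_dense fun b hb => ?_
  refine Lp.eLpNorm_le_of_ae_tendsto (u := atTop) (f := f) ?_
    (fun n => (hfsm n).continuous.aestronglyMeasurable)
    (ContDiffBump.ae_convolution_tendsto_right_of_locallyIntegrable hrOut hrle
      hu'.locallyIntegrable)
  filter_upwards [hlim.eventually_lt_const hb] with n hn using (hSob n).trans hn.le

end Mollification

/-! ### From energy estimates to `L^q` stability. -/

section Stability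

theorem abs_sub_le_of_memHolder {N : ℕ} {Ω : Set (Eucl N)} {β : ℝ≥0} {u : Eucl N → ℝ}
    (hu : MemHolder β (Ω.domRestrict u)) {x y : Eucl N} (hx : x ∈ Ω) (hy : y ∈ Ω) :
    |u x - u y| ≤ nnHolderNorm β (Ω.domRestrict u) * dist x y ^ (β : ℝ) :=
  hu.holderWith.dist_le (⟨x, hx⟩ : Ω) ⟨y, hy⟩

theorem memHolder_domRestrict_of_closure {N : ℕ} {Ω : Set (Eucl N)} {β : ℝ≥0} {u : Eucl N → ℝ}
    (hu : MemHolder β ((closure Ω).domRestrict u)) : MemHolder β (Ω.domRestrict u) := by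
  obtain ⟨C, hC⟩ := hu
  exact ⟨C, fun x y => hC ⟨x, subset_closure x.2⟩ ⟨y, subset_closure y.2⟩⟩

theorem ae_norm_le_toReal_eLpNorm_top {α F : Type*} [MeasurableSpace α] {μ : Measure α}
    [NormedAddCommGroup F] {f : α → F} (hf : eLpNorm f ∞ μ ≠ ⊤) :
    ∀ᵐ x ∂μ, ‖f x‖ ≤ (eLpNorm f ∞ μ).toReal := by
  filter_upwards [ae_le_eLpNormEssSup (f := f) (μ := μ)] with x hx
  rw [← eLpNorm_exponent_top] at hx
  have := ENNReal.toReal_mono hf hx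
  rwa [toReal_enorm] at this

/-- A Hölder function on a bounded set is bounded, so the essential supremum is finite and `toReal`
does not send `⊤` to `0`. -/
theorem ae_abs_le_of_memHolder {N : ℕ} {Ω : Set (Eucl N)} (hΩ : MeasurableSet Ω)
    (hbdd : Bornology.IsBounded Ω) {β : ℝ≥0} {u : Eucl N → ℝ}
    (hu : MemHolder β (Ω.domRestrict u)) :
    ∀ᵐ x ∂volume.restrict Ω, |u x| ≤ (eLpNorm u ∞ (volume.restrict Ω)).toReal := by
  refine ae_norm_le_toReal_eLpNorm_top (f := u) ?_
  rcases Ω.eq_empty_or_nonempty with rfl | ⟨x₀, hx₀⟩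
  · simp
  refine (eLpNormEssSup_lt_top_of_ae_bound (C := |u x₀| +
    nnHolderNorm β (Ω.domRestrict u) * Metric.diam Ω ^ (β : ℝ)) ?_).ne
  filter_upwards [ae_restrict_mem hΩ] with x hx
  have h1 := abs_sub_le_of_memHolder hu hx hx₀
  have h2 : dist x x₀ ^ (β : ℝ) ≤ Metric.diam Ω ^ (β : ℝ) :=
    Real.rpow_le_rpow dist_nonneg (Metric.dist_le_diam_of_mem hbdd hx hx₀) β.2
  have h3 := abs_sub_abs_le_abs_sub (u x) (u x₀)
  have h4 : (nnHolderNorm β (Ω.domRestrict u) : ℝ) * dist x x₀ ^ (β : ℝ) ≤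
      nnHolderNorm β (Ω.domRestrict u) * Metric.diam Ω ^ (β : ℝ) := by gcongr
  rw [Real.norm_eq_abs]
  linarith

theorem holderNorm_nonneg {N : ℕ} (Ω : Set (Eucl N)) (β : ℝ≥0) (u : Eucl N → ℝ) :
    0 ≤ holderNorm Ω β u := by unfold holderNorm; positivity

theorem ae_abs_sub_le_holderNorm {N : ℕ} {Ω : Set (Eucl N)} (hΩ : MeasurableSet Ω)
    (hbdd : Bornology.IsBounded Ω) {β : ℝ≥0} {u v : Eucl N → ℝ}
    (hu : MemHolder β (Ω.domRestrict u)) (hv : MemHolder β (Ω.domRestrict v)) :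
    ∀ᵐ x ∂volume.restrict Ω, |(u - v) x| ≤ holderNorm Ω β u + holderNorm Ω β v := by
  filter_upwards [ae_abs_le_of_memHolder hΩ hbdd hu, ae_abs_le_of_memHolder hΩ hbdd hv]
    with x h1 h2
  have h3 := abs_sub (u x) (v x)
  have h4 : (0 : ℝ) ≤ nnHolderNorm β (Ω.domRestrict u) := NNReal.coe_nonneg _
  have h5 : (0 : ℝ) ≤ nnHolderNorm β (Ω.domRestrict v) := NNReal.coe_nonneg _
  simp only [holderNorm, Pi.sub_apply]
  linarith

/-- Passing from an `L^q` bound for the difference of two Hölder functions to a sup bound. -/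
theorem exists_eLpNorm_top_sub_le {N : ℕ} {Ω : Set (Eucl N)} (hcone : UniformInteriorCone Ω)
    (hΩ : IsOpen Ω) (hbdd : Bornology.IsBounded Ω) {q : ℝ} (hq : 1 ≤ q) :
    ∃ K : ℝ, 1 ≤ K ∧ ∀ β : ℝ≥0, 0 < β → ∀ u v : Eucl N → ℝ,
      MemHolder β (Ω.domRestrict u) → MemHolder β (Ω.domRestrict v) →
      ∀ (R e : ℝ) (B : ℝ≥0∞), 0 ≤ R →
      eLpNorm (u - v) (ENNReal.ofReal q) (volume.restrict Ω) ≤ ENNReal.ofReal R * B ^ e →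
      eLpNorm (u - v) ∞ (volume.restrict Ω) ≤
        ENNReal.ofReal (K * (1 + (holderNorm Ω β u + holderNorm Ω β v)) * max 1 R) *
          B ^ (e * kappa N β q) := by
  obtain ⟨K, hK, h⟩ := exists_eLpNorm_top_le_of_holder hcone hΩ hq
  refine ⟨K, hK, fun β hβ u v hu hv R e B hR hX => ?_⟩
  have hβ' : (0 : ℝ) < β := hβ
  have hH : 0 ≤ holderNorm Ω β u + holderNorm Ω β v :=
    add_nonneg (holderNorm_nonneg _ _ _) (holderNorm_nonneg _ _ _)
  have hk0 : 0 ≤ kappa N β q := by unfold kappa; positivity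
  have hk1 : kappa N β q ≤ 1 := by
    unfold kappa
    rw [div_le_one (by positivity), le_add_iff_nonneg_right]
    positivity
  have key := h β hβ (u - v) _ hH (fun x hx y hy => ?_)
    (ae_abs_sub_le_holderNorm hΩ.measurableSet hbdd hu hv)
  · refine key.trans ?_
    calc _ ≤ ENNReal.ofReal (K * (1 + (holderNorm Ω β u + holderNorm Ω β v))) *
          (ENNReal.ofReal R * B ^ e) ^ kappa N β q := by gcongr
      _ = ENNReal.ofReal (K * (1 + (holderNorm Ω β u + holderNorm Ω β v)) * R ^ kappa N β q) *
          B ^ (e * kappa N β q) := by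
        rw [ENNReal.mul_rpow_of_nonneg _ _ hk0, ENNReal.ofReal_rpow_of_nonneg hR hk0,
          ← ENNReal.rpow_mul, ← mul_assoc, ← ENNReal.ofReal_mul (by positivity)]
      _ ≤ _ := by
        gcongr
        -- Since `κ_q ≤ 1`, `max 1 R` dominates the power uniformly in `β`.
        calc R ^ kappa N β q ≤ max 1 R ^ kappa N β q := by gcongr; exact le_max_right _ _
          _ ≤ max 1 R ^ (1 : ℝ) := Real.rpow_le_rpow_of_exponent_le (le_max_left _ _) hk1
          _ = _ := Real.rpow_one _
  · have h1 := abs_sub_le_of_memHolder hu hx hy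
    have h2 := abs_sub_le_of_memHolder hv hx hy
    have h3 : (u - v) x - (u - v) y = (u x - u y) - (v x - v y) := by
      simp only [Pi.sub_apply]; ring
    rw [h3]
    have h4 := abs_sub (u x - u y) (v x - v y)
    have h5 : (nnHolderNorm β (Ω.domRestrict u) : ℝ) ≤ holderNorm Ω β u := by
      unfold holderNorm; linarith [(ENNReal.toReal_nonneg : 0 ≤ (eLpNorm u ∞ (volume.restrict Ω)).toReal)]
    have h6 : (nnHolderNorm β (Ω.domRestrict v) : ℝ) ≤ holderNorm Ω β v := by
      unfold holderNorm; linarith [(ENNReal.toReal_nonneg : 0 ≤ (eLpNorm v ∞ (volume.restrict Ω)).toReal)]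
    have h7 : 0 ≤ dist x y ^ (β : ℝ) := by positivity
    nlinarith

/-- The gradient bound that follows from a coercivity estimate and Poincaré's inequality. -/
theorem eLpNorm_le_of_coercive {α F : Type*} [MeasurableSpace α] {μ : Measure α}
    [NormedAddCommGroup F] {r c : ℝ} (hr : 1 < r) (hc : 0 < c) {D C : ℝ≥0} {G : α → F}
    {w a : α → ℝ} {B : ℝ≥0∞} (hB : B ≠ ⊤) (hG : MemLp G (ENNReal.ofReal r) μ)
    (ha : AEStronglyMeasurable a μ) (hw : AEStronglyMeasurable w μ)
    (hcoer : c * ∫ x, ‖G x‖ ^ r ∂μ ≤ ∫ x, a x * w x ∂μ)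
    (haB : eLpNorm a (ENNReal.ofReal (r / (r - 1))) μ ≤ D * B)
    (hP : eLpNorm w (ENNReal.ofReal r) μ ≤ C * eLpNorm G (ENNReal.ofReal r) μ) :
    eLpNorm G (ENNReal.ofReal r) μ ≤
      ENNReal.ofReal ((C * D / c) ^ (1 / (r - 1))) * B ^ (1 / (r - 1)) := by
  have : ENNReal.HolderConjugate (ENNReal.ofReal (r / (r - 1))) (ENNReal.ofReal r) :=
    ((Real.holderConjugate_iff_eq_conjExponent hr).2 rfl).symm.ennrealOfReal
  have hr0 : 0 < r := by linarith
  have hr1 : 0 < r - 1 := by linarith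
  set Y := eLpNorm G (ENNReal.ofReal r) μ with hY
  set y := Y.toReal with hy
  set b := B.toReal with hb
  have hYtop : Y ≠ ⊤ := hG.2.ne
  have hI : ∫ x, ‖G x‖ ^ r ∂μ = y ^ r := by
    have h1 := hG.eLpNorm_eq_integral_rpow_norm (by simpa using hr0) ENNReal.ofReal_ne_top
    have h0 : 0 ≤ ∫ x, ‖G x‖ ^ r ∂μ := integral_nonneg fun x => by positivity
    rw [ENNReal.toReal_ofReal hr0.le] at h1
    rw [hy, hY, h1, ENNReal.toReal_ofReal (by positivity), ← Real.rpow_mul h0,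
      inv_mul_cancel₀ hr0.ne', Real.rpow_one]
  have hR : ∫ x, a x * w x ∂μ ≤ (D * b) * (C * y) := by
    have h1 := enorm_integral_inner_le (p := ENNReal.ofReal (r / (r - 1)))
      (q := ENNReal.ofReal r) ha hw
    simp only [RCLike.inner_apply, conj_trivial, mul_comm (w _)] at h1
    have h2 := h1.trans (mul_le_mul' haB hP)
    have h3 := ENNReal.toReal_mono (ENNReal.mul_ne_top (ENNReal.mul_ne_top ENNReal.coe_ne_top hB)
      (ENNReal.mul_ne_top ENNReal.coe_ne_top hYtop)) h2
    simp only [toReal_enorm, ENNReal.toReal_mul, ENNReal.coe_toReal] at h3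
    exact (le_abs_self _).trans h3
  rw [hI] at hcoer
  have hb0 : 0 ≤ b := ENNReal.toReal_nonneg
  have hmain : y ≤ (C * D / c * b) ^ (1 / (r - 1)) := by
    -- The energy estimate reads `c y^r ≤ C D b y`; one factor `y` is cancelled when it is positive.
    rcases (show 0 ≤ y from ENNReal.toReal_nonneg).eq_or_lt with h0 | h0
    · rw [← h0]; positivity
    have h1 : y ^ r = y ^ (r - 1) * y := by
      rw [← Real.rpow_add_one h0.ne']; ring_nf
    have h2 : y ^ (r - 1) ≤ C * D / c * b := by
      have h3 : c * y ^ (r - 1) * y ≤ (C * D * b) * y := by rw [h1] at hcoer; linarith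
      have h4 := le_of_mul_le_mul_right h3 h0
      rw [div_mul_eq_mul_div, le_div_iff₀ hc]
      linarith
    have h5 := Real.rpow_le_rpow (by positivity) h2 (by positivity : 0 ≤ 1 / (r - 1))
    rwa [← Real.rpow_mul h0.le, mul_one_div_cancel hr1.ne', Real.rpow_one] at h5
  calc Y = ENNReal.ofReal y := (ENNReal.ofReal_toReal hYtop).symm
    _ ≤ ENNReal.ofReal ((C * D / c * b) ^ (1 / (r - 1))) := ENNReal.ofReal_le_ofReal hmain
    _ = _ := by
      rw [Real.mul_rpow (by positivity) hb0, ENNReal.ofReal_mul (by positivity),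
        ← ENNReal.ofReal_rpow_of_nonneg hb0 (by positivity), ENNReal.ofReal_toReal hB]

theorem exists_eLpNorm_le_mul_eLpNorm_of_le {α : Type*} [MeasurableSpace α] {μ : Measure α}
    [IsFiniteMeasure μ] {r m : ℝ≥0∞} (hr : r ≠ 0) (hrm : r ≤ m) :
    ∃ D : ℝ≥0, ∀ a : α → ℝ, AEStronglyMeasurable a μ → eLpNorm a r μ ≤ D * eLpNorm a m μ := by
  have he : 0 ≤ 1 / r.toReal - 1 / m.toReal := by
    rcases eq_or_ne m ⊤ with rfl | hm
    · simp
    · have h0 : 0 < r.toReal := ENNReal.toReal_pos hr (ne_top_of_le_ne_top hm hrm)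
      have h1 := ENNReal.toReal_mono hm hrm
      exact sub_nonneg.2 (one_div_le_one_div_of_le h0 h1)
  have hV := ENNReal.rpow_ne_top_of_nonneg he (measure_ne_top μ univ)
  refine ⟨(μ univ ^ (1 / r.toReal - 1 / m.toReal)).toNNReal, fun a ha => ?_⟩
  rw [ENNReal.coe_toNNReal hV, mul_comm]
  exact eLpNorm_le_eLpNorm_mul_rpow_measure_univ hrm ha

/-- At the critical exponent the Sobolev relation is an equality; for `s ≥ N` its left side is
nonpositive. -/
theorem AdmissibleExponent.one_le_and_inv_sub_inv_le {N : ℕ} (hN : 1 ≤ N) {s q : ℝ} (hs : 1 ≤ s)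
    (h : AdmissibleExponent N s q) : 1 ≤ q ∧ s⁻¹ - (N : ℝ)⁻¹ ≤ q⁻¹ := by
  have hN0 : (1 : ℝ) ≤ N := by exact_mod_cast hN
  rcases h with ⟨hsN, rfl⟩ | ⟨hsN, hq⟩
  · have : (0 : ℝ) < N - s := by linarith
    refine ⟨by rw [le_div_iff₀ this]; nlinarith, le_of_eq ?_⟩
    have : (0 : ℝ) < N := by linarith
    have : 0 < s := by linarith
    field_simp
  · refine ⟨hq, ?_⟩
    have h1 : s⁻¹ ≤ (N : ℝ)⁻¹ := by gcongr
    have h2 : 0 ≤ q⁻¹ := by positivity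
    linarith

theorem integrable_smul_of_isTestFunction {N : ℕ} {Ω : Set (Eucl N)} {G : Eucl N → Eucl N}
    (hG : LocallyIntegrableOn G Ω) {φ : Eucl N → ℝ} (hφ : IsTestFunction Ω φ) :
    Integrable (fun x => φ x • G x) := by
  have h1 : IntegrableOn G (tsupport φ) := hG.integrableOn_compact_subset hφ.2.2 hφ.2.1
  obtain ⟨C, hC⟩ := hφ.1.continuous.bounded_above_of_compact_support hφ.2.1
  have h2 : IntegrableOn (fun x => φ x • G x) (tsupport φ) :=
    h1.bdd_smul C hφ.1.continuous.aestronglyMeasurable (Eventually.of_forall hC)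
  refine (integrableOn_iff_integrable_of_support_subset fun x hx => ?_).1 h2
  refine subset_tsupport φ fun h0 => hx ?_
  simp [h0]

/-- By the fundamental lemma of the calculus of variations. It transfers a bound on a given weak
gradient to the one appearing in the equation. -/
theorem HasWeakGradient.ae_eq {N : ℕ} {Ω : Set (Eucl N)} (hΩ : IsOpen Ω) {u : Eucl N → ℝ}
    {G G' : Eucl N → Eucl N} (h : HasWeakGradient Ω u G) (h' : HasWeakGradient Ω u G') :
    ∀ᵐ x ∂volume.restrict Ω, G x = G' x := by
  rw [ae_restrict_iff' hΩ.measurableSet]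
  have key := hΩ.ae_eq_zero_of_integral_contDiff_smul_eq_zero (f := G - G') (μ := volume)
    (h.2.1.sub h'.2.1) fun φ h1 h2 h3 => ?_
  · filter_upwards [key] with x hx hxΩ
    exact sub_eq_zero.1 (hx hxΩ)
  · have hφ : IsTestFunction Ω φ := ⟨h1, h2, h3⟩
    have e := (h.2.2 φ hφ).symm.trans (h'.2.2 φ hφ)
    have hz : ∀ F : Eucl N → Eucl N, ∫ x in Ω, φ x • F x = ∫ x, φ x • F x := fun F => by
      refine setIntegral_eq_integral_of_forall_compl_eq_zero fun x hx => ?_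
      have : φ x = 0 := by
        by_contra h0
        exact hx (hφ.support_subset h0)
      rw [this, zero_smul]
    rw [neg_inj, hz, hz] at e
    simp only [Pi.sub_apply, smul_sub]
    rw [integral_sub (integrable_smul_of_isTestFunction h.2.1 hφ)
      (integrable_smul_of_isTestFunction h'.2.1 hφ), e, sub_self]

/-- `L^q` stability of weak solutions in the degenerate case `p ≥ 2`. -/
theorem exists_eLpNorm_sub_le_of_two_le {N : ℕ} (hN : 1 ≤ N) {Ω : Set (Eucl N)}
    (hbdd : Bornology.IsBounded Ω) {p : ℝ} (hp : 2 ≤ p) {m : ℝ≥0∞}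
    (hpm : ENNReal.ofReal p / ENNReal.ofReal (p - 2) ≤ m) {q : ℝ} (hq : 1 ≤ q)
    (hpq : p⁻¹ - (N : ℝ)⁻¹ ≤ q⁻¹) :
    ∃ R : ℝ, 0 ≤ R ∧ ∀ a₁ a₂ u₁ u₂ : Eucl N → ℝ,
      MemLp a₁ m (volume.restrict Ω) → MemLp a₂ m (volume.restrict Ω) →
      IsWeakSolution Ω p a₁ u₁ → IsWeakSolution Ω p a₂ u₂ →
      ∀ M : ℝ, (∀ᵐ x ∂volume.restrict Ω, |(u₁ - u₂) x| < M) →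
      eLpNorm (u₁ - u₂) (ENNReal.ofReal q) (volume.restrict Ω) ≤
        ENNReal.ofReal R * eLpNorm (a₁ - a₂) m (volume.restrict Ω) ^ (1 / (p - 1)) := by
  have : IsFiniteMeasure (volume.restrict Ω) := ⟨by simpa using hbdd.measure_lt_top⟩
  have hp1 : 1 < p := by linarith
  have hp0 : 0 < p := by linarith
  -- The argument needs only `m ≥ p'`, which follows from `p/(p-1) ≤ p/(p-2)`; at `p = 2` the latter
  -- is `⊤`.
  have hpm' : ENNReal.ofReal (p / (p - 1)) ≤ m := by
    refine le_trans ?_ hpm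
    rw [ENNReal.ofReal_div_of_pos (by linarith)]
    gcongr
    linarith
  have hpr : 1 ≤ ENNReal.ofReal (p / (p - 1)) := by
    rw [ENNReal.one_le_ofReal, le_div_iff₀ (by linarith)]; linarith
  -- `C₀` is the Poincaré constant (`q = p`), which closes the energy estimate; `C₁` is the Sobolev
  -- constant for the target `q`.
  obtain ⟨C₀, hC₀⟩ := exists_eLpNorm_le_of_isTestLimit hN hbdd hp1.le hp1.le
    (sub_le_self _ (by positivity))
  obtain ⟨C₁, hC₁⟩ := exists_eLpNorm_le_of_isTestLimit hN hbdd hp1.le hq hpq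
  obtain ⟨D, hD⟩ := exists_eLpNorm_le_mul_eLpNorm_of_le (μ := volume.restrict Ω)
    (zero_lt_one.trans_le hpr).ne' hpm'
  refine ⟨C₁ * (C₀ * D / 2 ^ (1 - p)) ^ (1 / (p - 1)), by positivity, ?_⟩
  intro a₁ a₂ u₁ u₂ ha₁ ha₂ ⟨G₁, hG₁, heq₁⟩ ⟨G₂, hG₂, heq₂⟩ M hM
  have hm1 : 1 ≤ m := hpr.trans hpm'
  have ht := hG₁.isTestLimit.sub hp1.le hG₂.isTestLimit
  obtain ⟨hint, henergy⟩ := integral_inner_sub_eq_of_isTestLimit hp1 (ha₁.integrable hm1)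
    (ha₂.integrable hm1) hG₁.isTestLimit hG₂.isTestLimit heq₁ heq₂ hM
  have hcoer : 2 ^ (1 - p) * ∫ x in Ω, ‖(G₁ - G₂) x‖ ^ p ≤
      ∫ x in Ω, (a₁ - a₂) x * (u₁ - u₂) x := by
    simp only [Pi.sub_apply a₁ a₂]
    rw [← henergy, ← integral_const_mul]
    refine integral_mono_of_nonneg (Eventually.of_forall fun x => by positivity) hint
      (Eventually.of_forall fun x => ?_)
    exact le_inner_rpow_smul_sub_of_two_le hp (G₁ x) (G₂ x)
  have hgrad := eLpNorm_le_of_coercive hp1 (by positivity) (ha₁.sub ha₂).2.ne ht.2.1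
    (ha₁.sub ha₂).1 ht.1.1 hcoer (hD _ (ha₁.sub ha₂).1) (hC₀ _ _ ht)
  calc _ ≤ _ := hC₁ _ _ ht
    _ ≤ _ := mul_le_mul_right hgrad _
    _ = _ := by
      rw [← mul_assoc, ENNReal.ofReal_mul (by positivity), ENNReal.ofReal_coe_nnreal]

/-- `L^q` stability of Lipschitz weak solutions in the singular case `p ≤ 2`. -/
theorem exists_eLpNorm_sub_le_of_le_two {N : ℕ} (hN : 1 ≤ N) {Ω : Set (Eucl N)} (hΩ : IsOpen Ω)
    (hbdd : Bornology.IsBounded Ω) {p : ℝ} (hp1 : 1 < p) (hp : p ≤ 2) {m : ℝ≥0∞} (hm : 2 ≤ m)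
    {q : ℝ} (hq : 1 ≤ q) (hpq : (2 : ℝ)⁻¹ - (N : ℝ)⁻¹ ≤ q⁻¹) :
    ∃ R : ℝ → ℝ, (∀ L, 0 < L → 0 ≤ R L) ∧ ∀ L, 0 < L → ∀ a₁ a₂ u₁ u₂ : Eucl N → ℝ,
      MemLp a₁ m (volume.restrict Ω) → MemLp a₂ m (volume.restrict Ω) →
      IsWeakSolution Ω p a₁ u₁ → IsWeakSolution Ω p a₂ u₂ →
      ∀ G₁ G₂ : Eucl N → Eucl N, HasWeakGradient Ω u₁ G₁ → HasWeakGradient Ω u₂ G₂ →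
      (∀ᵐ x ∂volume.restrict Ω, ‖G₁ x‖ ≤ L) → (∀ᵐ x ∂volume.restrict Ω, ‖G₂ x‖ ≤ L) →
      ∀ M : ℝ, (∀ᵐ x ∂volume.restrict Ω, |(u₁ - u₂) x| < M) →
      eLpNorm (u₁ - u₂) (ENNReal.ofReal q) (volume.restrict Ω) ≤
        ENNReal.ofReal (R L) * eLpNorm (a₁ - a₂) m (volume.restrict Ω) ^ (1 : ℝ) := by
  have : IsFiniteMeasure (volume.restrict Ω) := ⟨by simpa using hbdd.measure_lt_top⟩
  obtain ⟨C₀, hC₀⟩ := exists_eLpNorm_le_of_isTestLimit_of_memLp_top hN hΩ.measurableSet hbdd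
    one_le_two one_le_two (sub_le_self _ (by positivity)) hp1
  obtain ⟨C₁, hC₁⟩ := exists_eLpNorm_le_of_isTestLimit_of_memLp_top hN hΩ.measurableSet hbdd
    one_le_two hq hpq hp1
  obtain ⟨D, hD⟩ := exists_eLpNorm_le_mul_eLpNorm_of_le (μ := volume.restrict Ω) two_ne_zero hm
  have hpp : 0 < p - 1 := by linarith
  refine ⟨fun L => C₁ * (C₀ * D / ((p - 1) * L ^ (p - 2))), fun L hL => by positivity, ?_⟩
  intro L hL a₁ a₂ u₁ u₂ ha₁ ha₂ ⟨F₁, hF₁, heq₁⟩ ⟨F₂, hF₂, heq₂⟩ G₁ G₂ hG₁ hG₂ hL₁ hL₂ M hM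
  have hF₁L : ∀ᵐ x ∂volume.restrict Ω, ‖F₁ x‖ ≤ L := by
    filter_upwards [hL₁, hF₁.2.2.1.ae_eq hΩ hG₁] with x h1 h2 using h2 ▸ h1
  have hF₂L : ∀ᵐ x ∂volume.restrict Ω, ‖F₂ x‖ ≤ L := by
    filter_upwards [hL₂, hF₂.2.2.1.ae_eq hΩ hG₂] with x h1 h2 using h2 ▸ h1
  have hm1 : 1 ≤ m := one_le_two.trans hm
  have ht := hF₁.isTestLimit.sub hp1.le hF₂.isTestLimit
  have htop : MemLp (F₁ - F₂) ∞ (volume.restrict Ω) :=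
    (memLp_top_of_bound hF₁.2.1.1 L hF₁L).sub (memLp_top_of_bound hF₂.2.1.1 L hF₂L)
  -- The coercivity is quadratic, so the energy argument runs with `r = 2` rather than `p`.
  have ht2 : MemLp (F₁ - F₂) (ENNReal.ofReal 2) (volume.restrict Ω) := htop.mono_exponent le_top
  obtain ⟨hint, henergy⟩ := integral_inner_sub_eq_of_isTestLimit hp1 (ha₁.integrable hm1)
    (ha₂.integrable hm1) hF₁.isTestLimit hF₂.isTestLimit heq₁ heq₂ hM
  have hcoer : (p - 1) * L ^ (p - 2) * ∫ x in Ω, ‖(F₁ - F₂) x‖ ^ (2 : ℝ) ≤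
      ∫ x in Ω, (a₁ - a₂) x * (u₁ - u₂) x := by
    simp only [Pi.sub_apply a₁ a₂]
    rw [← henergy, ← integral_const_mul]
    refine integral_mono_of_nonneg (Eventually.of_forall fun x => by positivity) hint ?_
    filter_upwards [hF₁L, hF₂L] with x h1 h2
    rw [Real.rpow_two]
    exact le_inner_rpow_smul_sub_of_le_two hp1 hp (F₁ x) (F₂ x) h1 h2
  have hgrad := eLpNorm_le_of_coercive one_lt_two (by positivity) (ha₁.sub ha₂).2.ne ht2
    (ha₁.sub ha₂).1 ht.1.1 hcoer
    (by norm_num; exact hD _ (ha₁.sub ha₂).1) (hC₀ _ _ ht htop)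
  have h21 : (1 : ℝ) / (2 - 1) = 1 := by norm_num
  rw [h21, Real.rpow_one] at hgrad
  calc _ ≤ _ := hC₁ _ _ ht htop
    _ ≤ _ := mul_le_mul_right hgrad _
    _ = _ := by
      rw [← mul_assoc, ENNReal.ofReal_mul (by positivity), ENNReal.ofReal_coe_nnreal]

end Stability

/-! ### Assembly of the two sup norm estimates. -/

theorem mainTheorem4 (N : ℕ) (hN : 1 ≤ N) (Ω : Set (Eucl N)) (hΩ : IsOpen Ω)
    (hbdd : Bornology.IsBounded Ω) (hcone : UniformInteriorCone Ω)
    (p : ℝ) (hp : 1 < p) (m : ℝ≥0∞) (hm : 1 < m) :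
    (2 ≤ p → ENNReal.ofReal p / ENNReal.ofReal (p - 2) ≤ m →
      ∀ q : ℝ, AdmissibleExponent N p q →
      ∃ C : ℝ → ℝ → ℝ, (∀ s t, 0 < C s t) ∧
        ∀ β : ℝ≥0, 0 < β → β ≤ 1 →
        ∀ a₁ a₂ u₁ u₂ : Eucl N → ℝ,
          MemLp a₁ m (volume.restrict Ω) → MemLp a₂ m (volume.restrict Ω) →
          IsPositiveHolderSolution Ω p β a₁ u₁ → IsPositiveHolderSolution Ω p β a₂ u₂ →
          eLpNorm (u₁ - u₂) ∞ (volume.restrict Ω) ≤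
            ENNReal.ofReal (C (holderNorm Ω β u₁) (holderNorm Ω β u₂)) *
              eLpNorm (a₁ - a₂) m (volume.restrict Ω) ^ (kappa N β q / (p - 1))) ∧
    (p ≤ 2 → 2 ≤ m →
      ∀ q : ℝ, AdmissibleExponent N 2 q →
      ∃ C : ℝ → ℝ → ℝ → ℝ → ℝ, (∀ s t s' t', 0 < C s t s' t') ∧
        ∀ β : ℝ≥0, 0 < β → β ≤ 1 →
        ∀ a₁ a₂ u₁ u₂ : Eucl N → ℝ,
          MemLp a₁ m (volume.restrict Ω) → MemLp a₂ m (volume.restrict Ω) →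
          IsPositiveHolderSolution Ω p β a₁ u₁ → IsPositiveHolderSolution Ω p β a₂ u₂ →
        ∀ G₁ G₂ : Eucl N → Eucl N,
          HasWeakGradient Ω u₁ G₁ → HasWeakGradient Ω u₂ G₂ →
          MemLp G₁ ∞ (volume.restrict Ω) → MemLp G₂ ∞ (volume.restrict Ω) →
          eLpNorm (u₁ - u₂) ∞ (volume.restrict Ω) ≤
            ENNReal.ofReal
                (C (holderNorm Ω β u₁) (holderNorm Ω β u₂) (supNorm Ω G₁) (supNorm Ω G₂)) *
              eLpNorm (a₁ - a₂) m (volume.restrict Ω) ^ kappa N β q) := by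
  have hΩm := hΩ.measurableSet
  constructor
  · intro hp2 hpm q hq
    obtain ⟨hq1, hpq⟩ := hq.one_le_and_inv_sub_inv_le hN hp.le
    obtain ⟨R, hR, hRb⟩ := exists_eLpNorm_sub_le_of_two_le hN hbdd hp2 hpm hq1 hpq
    obtain ⟨K, hK, hKb⟩ := exists_eLpNorm_top_sub_le hcone hΩ hbdd hq1
    -- Absolute values make the constant positive for all real arguments; they disappear at the
    -- actual norms.
    refine ⟨fun s t => K * (1 + (|s| + |t|)) * max 1 R, fun s t => by positivity, ?_⟩
    intro β hβ _ a₁ a₂ u₁ u₂ ha₁ ha₂ ⟨hw₁, _, hh₁⟩ ⟨hw₂, _, hh₂⟩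
    have hu₁ := memHolder_domRestrict_of_closure hh₁
    have hu₂ := memHolder_domRestrict_of_closure hh₂
    -- The strict bound serves only the truncation in the testing step and does not enter the
    -- constant.
    have hM := (ae_abs_sub_le_holderNorm hΩm hbdd hu₁ hu₂).mono fun x hx =>
      hx.trans_lt (lt_add_one _)
    have key := hKb β hβ u₁ u₂ hu₁ hu₂ R _ _ hR (hRb a₁ a₂ u₁ u₂ ha₁ ha₂ hw₁ hw₂ _ hM)
    rw [one_div_mul_eq_div] at key
    simpa only [abs_of_nonneg (holderNorm_nonneg _ _ _)] using key
  · intro hp2 hm2 q hq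
    obtain ⟨hq1, hpq⟩ := hq.one_le_and_inv_sub_inv_le hN one_le_two
    obtain ⟨R, hR, hRb⟩ := exists_eLpNorm_sub_le_of_le_two hN hΩ hbdd hp hp2 hm2 hq1 hpq
    obtain ⟨K, hK, hKb⟩ := exists_eLpNorm_top_sub_le hcone hΩ hbdd hq1
    -- The gradient bound is `L = 1 + ‖∇u₁‖_∞ + ‖∇u₂‖_∞`; the `1` keeps `L` positive, as `L^(p-2)`
    -- requires.
    refine ⟨fun s t s' t' => K * (1 + (|s| + |t|)) * max 1 (R (1 + (|s'| + |t'|))),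
      fun s t s' t' => by positivity, ?_⟩
    intro β hβ _ a₁ a₂ u₁ u₂ ha₁ ha₂ ⟨hw₁, _, hh₁⟩ ⟨hw₂, _, hh₂⟩ G₁ G₂ hG₁ hG₂ hb₁ hb₂
    have hu₁ := memHolder_domRestrict_of_closure hh₁
    have hu₂ := memHolder_domRestrict_of_closure hh₂
    have hM := (ae_abs_sub_le_holderNorm hΩm hbdd hu₁ hu₂).mono fun x hx =>
      hx.trans_lt (lt_add_one _)
    have hs₁ : 0 ≤ supNorm Ω G₁ := ENNReal.toReal_nonneg
    have hs₂ : 0 ≤ supNorm Ω G₂ := ENNReal.toReal_nonneg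
    have hL₁ : ∀ᵐ x ∂volume.restrict Ω, ‖G₁ x‖ ≤ 1 + (supNorm Ω G₁ + supNorm Ω G₂) := by
      filter_upwards [ae_norm_le_toReal_eLpNorm_top hb₁.2.ne] with x hx
      exact hx.trans (by rw [← supNorm]; linarith)
    have hL₂ : ∀ᵐ x ∂volume.restrict Ω, ‖G₂ x‖ ≤ 1 + (supNorm Ω G₁ + supNorm Ω G₂) := by
      filter_upwards [ae_norm_le_toReal_eLpNorm_top hb₂.2.ne] with x hx
      exact hx.trans (by rw [← supNorm]; linarith)
    have hL : 0 < 1 + (supNorm Ω G₁ + supNorm Ω G₂) := by positivity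
    have key := hKb β hβ u₁ u₂ hu₁ hu₂ _ _ _ (hR _ hL)
      (hRb _ hL a₁ a₂ u₁ u₂ ha₁ ha₂ hw₁ hw₂ G₁ G₂ hG₁ hG₂ hL₁ hL₂ _ hM)
    rw [one_mul] at key
    simpa only [abs_of_nonneg (holderNorm_nonneg _ _ _), abs_of_nonneg hs₁,
      abs_of_nonneg hs₂] using key
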